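/- \textbf{Theorem.} All algorithms are deterministic word-RAM programs. A $3$-OV instance consists of three families $A,B,C$ of $n\ge 1$ vectors in $\{0,1\}^d$, $d\ge 1$; a solution is a triple $a\in A$, $b\in B$, $c\in C$ with $\sum_{i=1}^d a[i]\,b[i]\,c[i]=0$. For a weighted undirected graph, $d(u,v)$ is the minimum total weight of a path from $u$ to $v$ ($\infty$ if there is none), and the Diameter is $\max_{u,v}d(u,v)$. (i) There is an algorithm (with words of $O(\log(n+d))$ bits) that, given a $3$-OV instance, constructs in $O(n^2d^2)$ time a weighted, undirected simple graph with $O(n^2+nd^2)$ vertices and $O(n^2d^2)$ edges, each edge having weight $1$ or $2$, such that \begin{itemize} \item if the $3$-OV instance has no solution, then $d(u,v)\le 6$ for all pairs of vertices $u,v$; \item if the $3$-OV instance has a solution, then there is a pair of vertices $u,v$ with $d(u,v)\ge 10$. \end{itemize} (ii) The Strong Exponential Time Hypothesis (SETH) states that for every $\varepsilon>0$ there is a $K$ such that satisfiability of $K$-CNF formulas with $N$ variables and $M$ clauses cannot be decided in time $2^{(1-\varepsilon)N}\,\mathrm{poly}(N+M)$ on a word-RAM (with words of $O(N+\log M)$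 bits). Assume SETH. Then there is a constant $C_0$ such that for all $\varepsilon,\delta>0$ there is no algorithm which, given a connected undirected graph with $n$ vertices, at most $C_0n$ edges and all edge weights in $\{1,2\}$, computes in time $O(n^{3/2-\delta})$ (with words of $O(\log n)$ bits) a $(5/3-\varepsilon)$-approximation of its Diameter $D$. Here an $\alpha$-approximation is a rational number $x$ with $\mathrm{lo}\cdot D\le x\le \mathrm{hi}\cdot D$ for constants $\mathrm{lo}>0$ and $\mathrm{hi}\le\alpha\cdot\mathrm{lo}$ fixed for the algorithm; this includes both conventions $D\le x\le\alpha D$ and $D/\alpha\le x\le D$. -/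

import Mathlib

/-! ### Word-RAM

A unit-cost random access machine with structured control flow.  Registers and memory cells hold
natural numbers.  The word length is enforced by a bound `W`: an execution is legal only if every
value it writes is smaller than `W`, so that `W = 2 ^ w` means words of `w` bits and
`W = x ^ c` with a constant `c` means words of `O(log x)` bits. -/

namespace WordRAM

/-- Binary word operations. Comparisons return `1` or `0`; `sub` is truncated at `0`. -/
inductive Op where
  | add | sub | mul | div | mod | and | or | xor | shl | shr | lt | eq

def Op.eval : Op → ℕ → ℕ → ℕ
  | .add, a, b => a + b
  | .sub, a, b => a - b
  | .mul, a, b => a * b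
  | .div, a, b => a / b
  | .mod, a, b => a % b
  | .and, a, b => a &&& b
  | .or, a, b => a ||| b
  | .xor, a, b => a ^^^ b
  | .shl, a, b => a <<< b
  | .shr, a, b => a >>> b
  | .lt, a, b => if a < b then 1 else 0
  | .eq, a, b => if a = b then 1 else 0

structure State where
  reg : ℕ → ℕ
  mem : ℕ → ℕ

/-- Elementary instructions, each of which costs one step. -/
inductive Instr where
  /-- `reg r := k` -/
  | const (r k : ℕ)
  /-- `reg r := o (reg a) (reg b)` -/
  | op (o : Op) (r a b : ℕ)
  /-- `reg r := mem (reg a)` -/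
  | load (r a : ℕ)
  /-- `mem (reg a) := reg b` -/
  | store (a b : ℕ)

/-- The word that an instruction writes. -/
def Instr.value : Instr → State → ℕ
  | .const _ k, _ => k
  | .op o _ a b, s => o.eval (s.reg a) (s.reg b)
  | .load _ a, s => s.mem (s.reg a)
  | .store _ b, s => s.reg b

def Instr.exec (i : Instr) (s : State) : State :=
  match i with
  | .const r _ => ⟨Function.update s.reg r (i.value s), s.mem⟩
  | .op _ r _ _ => ⟨Function.update s.reg r (i.value s), s.mem⟩
  | .load r _ => ⟨Function.update s.reg r (i.value s), s.mem⟩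
  | .store a _ => ⟨s.reg, Function.update s.mem (s.reg a) (i.value s)⟩

/-- Programs. A program is a fixed finite object, independent of the input. -/
inductive Prog where
  | skip
  | instr (i : Instr)
  | seq (p q : Prog)
  /-- if `reg r ≠ 0` then `p` else `q` -/
  | ite (r : ℕ) (p q : Prog)
  /-- while `reg r ≠ 0` do `p` -/
  | loop (r : ℕ) (p : Prog)

/-- `Runs W p s t s'`: started in state `s`, the program `p` halts after exactly `t` steps in
state `s'`, and every value written on the way is smaller than `W`.  Every instruction and every
test of a register costs one step. -/
inductive Runs (W : ℕ) : Prog → State → ℕ → State → Prop where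
  | skip (s : State) : Runs W .skip s 1 s
  | instr (i : Instr) (s : State) (h : i.value s < W) : Runs W (.instr i) s 1 (i.exec s)
  | seq {p q : Prog} {s s' s'' : State} {t t' : ℕ} (hp : Runs W p s t s')
      (hq : Runs W q s' t' s'') : Runs W (.seq p q) s (t + t') s''
  | ite_true {r : ℕ} {p q : Prog} {s s' : State} {t : ℕ} (hr : s.reg r ≠ 0)
      (hp : Runs W p s t s') : Runs W (.ite r p q) s (t + 1) s'
  | ite_false {r : ℕ} {p q : Prog} {s s' : State} {t : ℕ} (hr : s.reg r = 0)
      (hq : Runs W q s t s') : Runs W (.ite r p q) s (t + 1) s'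
  | loop_done {r : ℕ} {p : Prog} {s : State} (hr : s.reg r = 0) : Runs W (.loop r p) s 1 s
  | loop_step {r : ℕ} {p : Prog} {s s' s'' : State} {t t' : ℕ} (hr : s.reg r ≠ 0)
      (hp : Runs W p s t s') (hl : Runs W (.loop r p) s' t' s'') :
      Runs W (.loop r p) s (t + t' + 1) s''

/-- Initial state: the input words in the cells `0, 1, 2, …`, everything else zero. -/
def initState (input : List ℕ) : State where
  reg := fun _ => 0
  mem := fun i => input.getD i 0

/-- On the given input, whose words are smaller than `W`, the program halts after `t` steps in
state `s`, all words staying smaller than `W`. -/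
def HaltsOn (W : ℕ) (p : Prog) (input : List ℕ) (t : ℕ) (s : State) : Prop :=
  (∀ x ∈ input, x < W) ∧ Runs W p (initState input) t s

/-- The memory starts with the words `output`. -/
def State.Outputs (s : State) (output : List ℕ) : Prop :=
  ∀ i (h : i < output.length), s.mem i = output[i]

end WordRAM

/-! ### Weighted undirected graphs -/

/-- A simple undirected graph with edge weights; the values of `weight` off the edges are never
used. -/
structure WeightedGraph (V : Type*) where
  graph : SimpleGraph V
  weight : Sym2 V → ℕ

namespace WeightedGraph

variable {V : Type*} (G : WeightedGraph V)

/-- The total weight of a walk. -/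
def walkLength {u v : V} (p : G.graph.Walk u v) : ℕ := (p.edges.map G.weight).sum

/-- Weighted distance, `⊤` if there is no path. -/
noncomputable def dist (u v : V) : ℕ∞ := ⨅ p : G.graph.Walk u v, (G.walkLength p : ℕ∞)

noncomputable def diameter : ℕ∞ := ⨆ u : V, ⨆ v : V, G.dist u v

/-- Each edge has weight `1` or `2`. -/
def WeightsOneOrTwo : Prop := ∀ e ∈ G.graph.edgeSet, G.weight e = 1 ∨ G.weight e = 2

end WeightedGraph

/-- `L` lists every edge of `G` exactly once (in one of its two orientations, in any order),
together with its weight. -/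
def IsEdgeList {n : ℕ} (G : WeightedGraph (Fin n)) (L : List (Fin n × Fin n × ℕ)) : Prop :=
  (L.map fun e => s(e.1, e.2.1)).Nodup ∧
  (∀ e, e ∈ G.graph.edgeSet ↔ e ∈ L.map fun e => s(e.1, e.2.1)) ∧
  ∀ e ∈ L, G.weight s(e.1, e.2.1) = e.2.2

/-- Number of vertices, number of edges, then the triples (endpoint, endpoint, weight). -/
def encodeGraph (n : ℕ) (L : List (Fin n × Fin n × ℕ)) : List ℕ :=
  n :: L.length :: L.flatMap fun e => [(e.1 : ℕ), (e.2.1 : ℕ), e.2.2]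

/-! ### Orthogonal vectors -/

/-- An instance of `k`-OV: `k` families of `n` vectors in `{0,1}^d`. -/
def OVInstance (k n d : ℕ) : Type := Fin k → Fin n → Fin d → Bool

/-- One can choose a vector from each family so that the generalized inner product is `0`. -/
def OVInstance.HasSolution {k n d : ℕ} (I : OVInstance k n d) : Prop :=
  ∃ f : Fin k → Fin n, ∑ x : Fin d, ∏ j : Fin k, (I j (f j) x).toNat = 0

/-- `n`, `d`, then all bits, family by family and vector by vector. -/
def OVInstance.encode {k n d : ℕ} (I : OVInstance k n d) : List ℕ :=
  n :: d :: (List.finRange k).flatMap fun j => (List.finRange n).flatMap fun i =>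
    (List.finRange d).map fun x => (I j i x).toNat

/-! ### Satisfiability and the Strong Exponential Time Hypothesis -/

/-- A CNF formula on `N` variables: a list of clauses, each of which is a list of literals; the
literal `(v, true)` is the variable `v`, and `(v, false)` is its negation. -/
abbrev CNF (N : ℕ) : Type := List (List (Fin N × Bool))

def CNF.Satisfiable {N : ℕ} (φ : CNF N) : Prop :=
  ∃ σ : Fin N → Bool, ∀ cl ∈ φ, ∃ l ∈ cl, σ l.1 = l.2

/-- `N`, the number of clauses, then each clause as its length followed by its literals. -/
def CNF.encode {N : ℕ} (φ : CNF N) : List ℕ :=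
  N :: φ.length :: φ.flatMap fun cl => cl.length :: cl.map fun l => 2 * (l.1 : ℕ) + l.2.toNat

/-- Satisfiability of CNF formulas with `N` variables, `M` clauses and at most `K` literals per
clause is decidable (answer in register `0`) in time `2 ^ ((1 - ε) N) * poly (N + M)` on a
word-RAM with words of `O(N + log M)` bits.  Words must be long enough to address the memory that
an exponential-time algorithm uses.  Up to repetitions, there are only polynomially many clauses
for fixed `K`, so that `poly (N + M)` means `poly N`. -/
def KSATSolvable (K : ℕ) (ε : ℝ) : Prop :=
  ∃ (P : WordRAM.Prog) (c : ℕ), ∀ (N : ℕ) (φ : CNF N), (∀ cl ∈ φ, cl.length ≤ K) →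
    ∃ (t : ℕ) (s : WordRAM.State),
      WordRAM.HaltsOn ((2 ^ N * (φ.length + 2)) ^ c) P φ.encode t s ∧
      (t : ℝ) ≤ c * (2 : ℝ) ^ ((1 - ε) * N) * ((N : ℝ) + φ.length + 1) ^ c ∧
      (s.reg 0 ≠ 0 ↔ φ.Satisfiable)

/-- The Strong Exponential Time Hypothesis. -/
def SETH : Prop := ∀ ε : ℝ, 0 < ε → ∃ K : ℕ, ¬ KSATSolvable K ε

/-! ### Approximating the diameter -/

/-- There is a word-RAM algorithm with words of `O(log n)` bits which, on every connected
undirected graph with `n ≥ 1` vertices, at most `C₀ * n` edges and all edge weights in `{1, 2}`,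
runs in time `O(n ^ τ)` and outputs a rational number `x` (numerator in register `0`, denominator
in register `1`) such that `lo * D ≤ x ≤ hi * D`, where `D` is the diameter.  (For `n ≥ 1`,
connected means that the diameter is finite.)  An `α`-approximation is the case
`(lo, hi) = (1, α)`, or `(lo, hi) = (1 / α, 1)` for estimates from below. -/
def SparseDiameterApprox (C₀ : ℕ) (lo hi τ : ℝ) : Prop :=
  ∃ (P : WordRAM.Prog) (c : ℕ), ∀ (n D : ℕ) (G : WeightedGraph (Fin n))
    (L : List (Fin n × Fin n × ℕ)), 0 < n → IsEdgeList G L → L.length ≤ C₀ * n →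
    G.WeightsOneOrTwo → G.diameter = D →
    ∃ (t : ℕ) (s : WordRAM.State),
      WordRAM.HaltsOn ((n + 2) ^ c) P (encodeGraph n L) t s ∧
      (t : ℝ) ≤ c * (n : ℝ) ^ τ ∧
      s.reg 1 ≠ 0 ∧
      lo * D ≤ (s.reg 0 : ℝ) / s.reg 1 ∧ (s.reg 0 : ℝ) / s.reg 1 ≤ hi * D

/-!
Fix vectors `a`, `b`, `b'`, `c` of a `3`-OV instance.  If `x` is a common one of `a`, `b`, `c`, and
`y` is a common one of `a`, `b'`, `c`, then `pair (0, a) b`, `coords (0, a) x y`,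
`coords (1, c) y x`, `pair (1, c) b'` is a path of weight `6`.  Hence these distances are at most
`6` if there is no solution, and the center and the anchors keep all other distances at most `6`.
If `a`, `b`, `c` is a solution, then a function on the vertices that changes along every edge by at
most the weight of the edge separates `pair (0, a) b` from `pair (1, c) b` by `10`.

The assignments to three blocks of `N / 3` variables turn a CNF formula into a `3`-OV instance with
`n = 2 ^ (N / 3)` and one coordinate per clause.  Leaves at the center make its graph sparse and
leave the other distances unchanged, so that a gap better than `10 / 6` in time
`(n ^ 2) ^ (3 / 2 - δ)`, up to factors that are polynomial in the number of clauses, decides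
satisfiability in time `2 ^ ((1 - 2 * δ / 3) * N)`.

Both reductions replace the contents of the memory by another list.  Such programs are compiled
from a language of nested loops, for which the printed list, the running time and the absence of
overflows can be read off the syntax.
-/

namespace WordRAM

theorem Runs.mono {W W' : ℕ} (h : W ≤ W') {p : Prog} {s s' : State} {t : ℕ}
    (hrun : Runs W p s t s') : Runs W' p s t s' := by
  induction hrun with
  | skip s => exact .skip s
  | instr i s hv => exact .instr i s (hv.trans_le h)
  | seq _ _ ihp ihq => exact .seq ihp ihq
  | ite_true hr _ ih => exact .ite_true hr ih
  | ite_false hr _ ih => exact .ite_false hr ih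
  | loop_done hr => exact .loop_done hr
  | loop_step hr _ _ ihp ihl => exact .loop_step hr ihp ihl

theorem Runs.reg_lt_and_mem_lt {W : ℕ} {p : Prog} {s s' : State} {t : ℕ}
    (hrun : Runs W p s t s') (h : (∀ k, s.reg k < W) ∧ ∀ k, s.mem k < W) :
    (∀ k, s'.reg k < W) ∧ ∀ k, s'.mem k < W := by
  have update_lt {f : ℕ → ℕ} {a x : ℕ} (hf : ∀ k, f k < W) (hx : x < W) (k : ℕ) :
      Function.update f a x k < W := by
    rw [Function.update_apply]
    split_ifs
    exacts [hx, hf k]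
  induction hrun with
  | skip _ | loop_done _ => exact h
  | instr i s hv =>
    cases i with
    | store a b => exact ⟨h.1, update_lt h.2 hv⟩
    | _ => exact ⟨update_lt h.1 hv, h.2⟩
  | seq _ _ ihp ihq => exact ihq (ihp h)
  | ite_true _ _ ih | ite_false _ _ ih => exact ih h
  | loop_step _ _ _ ihp ihl => exact ihl (ihp h)

/-- A strict upper bound for the registers that an instruction writes. -/
def Instr.regBound : Instr → ℕ
  | .const r _ | .op _ r _ _ | .load r _ => r + 1
  | .store _ _ => 0

/-- A strict upper bound for the registers that a program writes. -/
def Prog.regBound : Prog → ℕ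
  | .skip => 0
  | .instr i => i.regBound
  | .seq p q | .ite _ p q => max p.regBound q.regBound
  | .loop _ p => p.regBound

theorem Runs.reg_eq {W : ℕ} {p : Prog} {s s' : State} {t k : ℕ}
    (hrun : Runs W p s t s') (hk : p.regBound ≤ k) : s'.reg k = s.reg k := by
  induction hrun with
  | skip _ | loop_done _ => rfl
  | instr i s _ =>
    cases i with
    | store => rfl
    | _ =>
      simp only [Prog.regBound, Instr.regBound] at hk
      exact Function.update_of_ne (by omega) _ _
  | seq _ _ ihp ihq =>
    rw [Prog.regBound, max_le_iff] at hk
    rw [ihq hk.2, ihp hk.1]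
  | ite_true _ _ ih => exact ih ((le_max_left _ _).trans hk)
  | ite_false _ _ ih => exact ih ((le_max_right _ _).trans hk)
  | loop_step _ _ _ ihp ihl => rw [ihl hk, ihp hk]

/-- The program that sets the registers below `k` to zero. -/
def clearRegs : ℕ → Prog
  | 0 => .skip
  | k + 1 => .seq (clearRegs k) (.instr (.const k 0))

theorem runs_clearRegs {W : ℕ} (hW : 0 < W) (k : ℕ) (s : State) :
    Runs W (clearRegs k) s (k + 1) ⟨fun r => if r < k then 0 else s.reg r, s.mem⟩ := by
  induction k with
  | zero =>
    simp only [Nat.not_lt_zero, if_false]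
    exact .skip s
  | succ k ih =>
    have hreg : (fun r => if r < k + 1 then 0 else s.reg r) =
        Function.update (fun r => if r < k then 0 else s.reg r) k 0 := by
      funext r
      grind [Function.update_apply]
    rw [hreg]
    exact .seq ih (.instr (.const k 0) _ hW)

/-! ### Arithmetic expressions -/

/-- Arithmetic expressions over the values of local variables and the contents of the memory. -/
inductive Expr where
  | const (k : ℕ)
  | var (i : ℕ)
  | op (o : Op) (a b : Expr)
  | load (a : Expr)

namespace Expr

instance : Add Expr := ⟨op .add⟩
instance : Sub Expr := ⟨op .sub⟩
instance : Mul Expr := ⟨op .mul⟩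
instance : Div Expr := ⟨op .div⟩
instance : Mod Expr := ⟨op .mod⟩
instance {n : ℕ} : OfNat Expr n := ⟨const n⟩

/-- The value of an expression if the memory is `M` and the local variables are
`Γ[0], Γ[1], …`. -/
def eval (M : ℕ → ℕ) (Γ : List ℕ) : Expr → ℕ
  | const k => k
  | var i => Γ.getD i 0
  | op o a b => o.eval (a.eval M Γ) (b.eval M Γ)
  | load a => M (a.eval M Γ)

/-- Evaluation into the register `r`. The variable `i` is kept in the register `i + 1`, and the
registers from `r` on are free. -/
def compile : Expr → ℕ → Prog
  | const k, r => .instr (.const r k)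
  | var i, r => .instr (.op .or r (i + 1) (i + 1))
  | op o a b, r => .seq (a.compile r) (.seq (b.compile (r + 1)) (.instr (.op o r r (r + 1))))
  | load a, r => .seq (a.compile r) (.instr (.load r r))

/-- The running time of the compiled expression. -/
def cost : Expr → ℕ
  | const _ | var _ => 1
  | op _ a b => a.cost + (b.cost + 1)
  | load a => a.cost + 1

/-- If the variables and the words in memory are smaller than `X`, then the values of safe
subexpressions are smaller than `X ^ deg`. -/
def deg : Expr → ℕ
  | const k => k + 1
  | var _ => 1
  | op .add a b => max a.deg b.deg + 1
  | op .mul a b => a.deg + b.deg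
  | op _ a b => max a.deg b.deg
  | load a => a.deg

/-- The expression reads only variables that exist and memory cells in `R`, and operations that
may be exponential or are not monotone give values smaller than `X`. -/
def Safe (X : ℕ) (R : Set ℕ) (M : ℕ → ℕ) (Γ : List ℕ) : Expr → Prop
  | const _ => True
  | var i => i < Γ.length
  | op .or a b => a.Safe X R M Γ ∧ b.Safe X R M Γ ∧ a.eval M Γ ||| b.eval M Γ < X
  | op .xor a b => a.Safe X R M Γ ∧ b.Safe X R M Γ ∧ a.eval M Γ ^^^ b.eval M Γ < X
  | op .shl a b => a.Safe X R M Γ ∧ b.Safe X R M Γ ∧ a.eval M Γ <<< b.eval M Γ < X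
  | op _ a b => a.Safe X R M Γ ∧ b.Safe X R M Γ
  | load a => a.Safe X R M Γ ∧ a.eval M Γ ∈ R

section simpLemmas
variable {X n : ℕ} {R : Set ℕ} {M : ℕ → ℕ} {Γ : List ℕ} {a b : Expr}

@[simp] theorem eval_var : (var n).eval M Γ = Γ.getD n 0 := rfl
@[simp] theorem eval_const : (const n).eval M Γ = n := rfl
@[simp] theorem eval_ofNat : (no_index (OfNat.ofNat n : Expr)).eval M Γ = n := rfl
@[simp] theorem eval_load : (load a).eval M Γ = M (a.eval M Γ) := rfl
@[simp] theorem eval_op (o : Op) : (op o a b).eval M Γ = o.eval (a.eval M Γ) (b.eval M Γ) := rfl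
@[simp] theorem eval_add : (a + b).eval M Γ = a.eval M Γ + b.eval M Γ := rfl
@[simp] theorem eval_sub : (a - b).eval M Γ = a.eval M Γ - b.eval M Γ := rfl
@[simp] theorem eval_mul : (a * b).eval M Γ = a.eval M Γ * b.eval M Γ := rfl
@[simp] theorem eval_div : (a / b).eval M Γ = a.eval M Γ / b.eval M Γ := rfl
@[simp] theorem eval_mod : (a % b).eval M Γ = a.eval M Γ % b.eval M Γ := rfl

@[simp] theorem cost_var : (var n).cost = 1 := rfl
@[simp] theorem cost_const : (const n).cost = 1 := rfl
@[simp] theorem cost_ofNat : (no_index (OfNat.ofNat n : Expr)).cost = 1 := rfl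
@[simp] theorem cost_load : (load a).cost = a.cost + 1 := rfl
@[simp] theorem cost_op (o : Op) : (op o a b).cost = a.cost + (b.cost + 1) := rfl
@[simp] theorem cost_add : (a + b).cost = a.cost + (b.cost + 1) := rfl
@[simp] theorem cost_sub : (a - b).cost = a.cost + (b.cost + 1) := rfl
@[simp] theorem cost_mul : (a * b).cost = a.cost + (b.cost + 1) := rfl
@[simp] theorem cost_div : (a / b).cost = a.cost + (b.cost + 1) := rfl

@[simp] theorem safe_var : (var n).Safe X R M Γ ↔ n < Γ.length := .rfl
@[simp] theorem safe_const : (const n).Safe X R M Γ := trivial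
@[simp] theorem safe_ofNat : (no_index (OfNat.ofNat n : Expr)).Safe X R M Γ := trivial
@[simp] theorem safe_load : (load a).Safe X R M Γ ↔ a.Safe X R M Γ ∧ a.eval M Γ ∈ R := .rfl
@[simp] theorem safe_add : (a + b).Safe X R M Γ ↔ a.Safe X R M Γ ∧ b.Safe X R M Γ := .rfl
@[simp] theorem safe_sub : (a - b).Safe X R M Γ ↔ a.Safe X R M Γ ∧ b.Safe X R M Γ := .rfl
@[simp] theorem safe_mul : (a * b).Safe X R M Γ ↔ a.Safe X R M Γ ∧ b.Safe X R M Γ := .rfl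
@[simp] theorem safe_div : (a / b).Safe X R M Γ ↔ a.Safe X R M Γ ∧ b.Safe X R M Γ := .rfl
@[simp] theorem safe_lt : (op .lt a b).Safe X R M Γ ↔ a.Safe X R M Γ ∧ b.Safe X R M Γ := .rfl
@[simp] theorem safe_shl : (op .shl a b).Safe X R M Γ ↔
    a.Safe X R M Γ ∧ b.Safe X R M Γ ∧ a.eval M Γ <<< b.eval M Γ < X := .rfl

end simpLemmas

theorem one_le_deg (e : Expr) : 1 ≤ e.deg := by
  induction e with
  | const | var => simp [deg]
  | op o _ _ iha ihb => cases o <;> simp only [deg] <;> omega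
  | load _ iha => exact iha

theorem deg_le_deg_op (o : Op) (a b : Expr) : max a.deg b.deg ≤ (op o a b).deg := by
  have ha := a.one_le_deg
  have hb := b.one_le_deg
  cases o <;> simp only [deg] <;> omega

theorem Safe.of_op {X : ℕ} {R : Set ℕ} {M : ℕ → ℕ} {Γ : List ℕ} {o : Op} {a b : Expr}
    (h : (op o a b).Safe X R M Γ) : a.Safe X R M Γ ∧ b.Safe X R M Γ := by
  cases o <;> simp only [Safe] at h <;> tauto

theorem Safe.eval_lt {X : ℕ} {R : Set ℕ} {M : ℕ → ℕ} {Γ : List ℕ} (hX : 2 ≤ X)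
    (hΓ : ∀ x ∈ Γ, x < X) (hM : ∀ a ∈ R, M a < X) {e : Expr} (he : e.Safe X R M Γ) :
    e.eval M Γ < X ^ e.deg := by
  have pow_mono {m n : ℕ} (h : m ≤ n) : X ^ m ≤ X ^ n := Nat.pow_le_pow_right (by omega) h
  have lt_of_lt {x : ℕ} (e : Expr) (h : x < X) : x < X ^ e.deg :=
    h.trans_le (by simpa using pow_mono e.one_le_deg)
  induction e with
  | const k =>
    exact Nat.lt_two_pow_self.trans_le ((Nat.pow_le_pow_left hX k).trans (pow_mono (Nat.le_succ k)))
  | var i =>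
    rw [eval, List.getD_eq_getElem _ _ he]
    exact lt_of_lt _ (hΓ _ (List.getElem_mem he))
  | load a _ => exact lt_of_lt a (hM _ he.2)
  | op o a b iha ihb =>
    replace iha := iha he.of_op.1
    replace ihb := ihb he.of_op.2
    have hab := iha.trans_le (pow_mono ((le_max_left _ _).trans (deg_le_deg_op o a b)))
    have one_lt := lt_of_lt (op o a b) (show 1 < X by omega)
    cases o with
    | add =>
      have hmax_a := pow_mono (le_max_left a.deg b.deg)
      have hmax_b := pow_mono (le_max_right a.deg b.deg)
      simp only [eval, Op.eval, deg, pow_succ]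
      nlinarith
    | mul =>
      simp only [eval, Op.eval, deg, pow_add]
      exact Nat.mul_lt_mul'' iha ihb
    | sub => exact (Nat.sub_le _ _).trans_lt hab
    | div => exact (Nat.div_le_self _ _).trans_lt hab
    | mod => exact (Nat.mod_le _ _).trans_lt hab
    | and => exact Nat.and_le_left.trans_lt hab
    | shr => exact (Nat.shiftRight_le _ _).trans_lt hab
    | or | xor | shl => exact lt_of_lt _ he.2.2
    | lt | eq =>
      simp only [eval, Op.eval]
      split_ifs <;> omega

end Expr

/-- The values of the local variables `0, 1, …` are `Γ`; they are kept in the registers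
`1, 2, …`. -/
def State.HasVars (s : State) (Γ : List ℕ) : Prop := ∀ i < Γ.length, s.reg (i + 1) = Γ.getD i 0

/-- Assign the value of an expression to the variable `i`, if `k` variables are in use. -/
def Expr.assign (e : Expr) (k i : ℕ) : Prog :=
  .seq (e.compile (k + 1)) (.instr (.op .or (i + 1) (k + 1) (k + 1)))

/-- Write the value of an expression at the address in the register `0` and increment that
register, if `k` variables are in use. -/
def Expr.emit (e : Expr) (k : ℕ) : Prog :=
  .seq (e.compile (k + 1)) (.seq (.instr (.store 0 (k + 1)))
    (.seq (.instr (.const (k + 1) 1)) (.instr (.op .add 0 0 (k + 1)))))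

theorem Expr.runs_compile {W X : ℕ} {R : Set ℕ} {M : ℕ → ℕ} {Γ : List ℕ} (hX : 2 ≤ X)
    (hΓ : ∀ x ∈ Γ, x < X) (hM : ∀ a ∈ R, M a < X) {e : Expr} (he : e.Safe X R M Γ)
    (hW : X ^ e.deg ≤ W) {r : ℕ} (hr : Γ.length < r) {s : State} (hs : s.HasVars Γ)
    (hmem : Set.EqOn s.mem M R) :
    ∃ s', Runs W (e.compile r) s e.cost s' ∧ s'.reg r = e.eval M Γ ∧
      (∀ k < r, s'.reg k = s.reg k) ∧ s'.mem = s.mem := by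
  have hlt := (he.eval_lt hX hΓ hM).trans_le hW
  induction e generalizing r s with
  | const k =>
    exact ⟨_, .instr _ s hlt, by simp [Instr.exec, Instr.value, eval],
      fun k hk => by simp [Instr.exec, hk.ne], rfl⟩
  | var i =>
    have hi : (s.reg (i + 1)) ||| (s.reg (i + 1)) = Γ.getD i 0 := by rw [Nat.or_self, hs i he]
    exact ⟨_, .instr _ s (hi.trans_lt hlt), by simpa [Instr.exec, Instr.value, Op.eval] using hi,
      fun k hk => by simp [Instr.exec, hk.ne], rfl⟩
  | op o a b iha ihb =>
    have pow_le {m : ℕ} (h : m ≤ max a.deg b.deg) : X ^ m ≤ W :=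
      (Nat.pow_le_pow_right (by omega) (h.trans (deg_le_deg_op o a b))).trans hW
    obtain ⟨ha, hb⟩ := he.of_op
    have hWa := pow_le (le_max_left _ _)
    have hWb := pow_le (le_max_right _ _)
    obtain ⟨s₁, run₁, val₁, reg₁, mem₁⟩ :=
      iha ha hWa hr hs hmem ((ha.eval_lt hX hΓ hM).trans_le hWa)
    obtain ⟨s₂, run₂, val₂, reg₂, mem₂⟩ := ihb (r := r + 1) (s := s₁) hb hWb (by omega)
      (fun i hi => by rw [reg₁ _ (by omega), hs i hi]) (by rwa [mem₁])
      ((hb.eval_lt hX hΓ hM).trans_le hWb)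
    have val : o.eval (s₂.reg r) (s₂.reg (r + 1)) = (op o a b).eval M Γ := by
      rw [reg₂ r (by omega), val₁, val₂, eval_op]
    refine ⟨_, .seq run₁ (.seq run₂ (.instr _ s₂ (val.trans_lt hlt))), ?_,
      fun k hk => ?_, mem₂.trans mem₁⟩
    · simpa [Instr.exec, Instr.value] using val
    · simp [Instr.exec, hk.ne, reg₂ k (by omega), reg₁ k hk]
  | load a iha =>
    obtain ⟨s₁, run₁, val₁, reg₁, mem₁⟩ :=
      iha he.1 hW hr hs hmem ((he.1.eval_lt hX hΓ hM).trans_le hW)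
    have val : s₁.mem (s₁.reg r) = M (a.eval M Γ) := by rw [val₁, mem₁, hmem he.2]
    refine ⟨_, .seq run₁ (.instr _ s₁ (val.trans_lt hlt)), ?_, fun k hk => ?_, mem₁⟩
    · simpa [Instr.exec, Instr.value] using val
    · simpa [Instr.exec, hk.ne] using reg₁ k hk

/-! ### Programs that append a list to the memory -/

/-- The memory `m`, overwritten by the list `l` from the address `p` on. -/
def writeList (m : ℕ → ℕ) (p : ℕ) (l : List ℕ) : ℕ → ℕ :=
  fun a => if p ≤ a ∧ a < p + l.length then l.getD (a - p) 0 else m a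

@[simp] theorem writeList_nil (m : ℕ → ℕ) (p : ℕ) : writeList m p [] = m := by
  grind [writeList]

theorem writeList_singleton (m : ℕ → ℕ) (p x : ℕ) :
    writeList m p [x] = Function.update m p x := by
  funext a
  obtain rfl | ha := eq_or_ne a p
  · simp [writeList]
  · rw [writeList, if_neg (by rw [List.length_singleton]; omega), Function.update_of_ne ha]

theorem writeList_append (m : ℕ → ℕ) (p : ℕ) (l l' : List ℕ) :
    writeList (writeList m p l) (p + l.length) l' = writeList m p (l ++ l') := by
  funext a
  simp only [writeList, List.length_append]
  split_ifs with hl' hl hl <;> try omega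
  · rw [List.getD_append_right _ _ _ _ (by omega), Nat.sub_sub]
  · rw [List.getD_append _ _ _ _ (by omega)]

/-- Started with a write pointer in the register `0`, with variables `Γ`, and with a memory that
agrees with `M` on `R`, the program halts after at most `T` steps with variables `Γ'`, having
written the list `out` at the write pointer and having moved the pointer to the end of it.  This is
required only if the list fits into the memory and does not hit `R`. -/
def Exec (W : ℕ) (R : Set ℕ) (M : ℕ → ℕ) (p : Prog) (T : ℕ) (Γ Γ' out : List ℕ) : Prop :=
  ∀ s : State, s.HasVars Γ → Set.EqOn s.mem M R →
    (∀ a ∈ R, a < s.reg 0 ∨ s.reg 0 + out.length ≤ a) → s.reg 0 + out.length < W →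
    ∃ t ≤ T, ∃ s', Runs W p s t s' ∧ s'.reg 0 = s.reg 0 + out.length ∧
      s'.HasVars Γ' ∧ s'.mem = writeList s.mem (s.reg 0) out

namespace Exec
variable {W : ℕ} {R : Set ℕ} {M : ℕ → ℕ} {p q : Prog} {T T' : ℕ} {Γ Γ' Γ'' out out' : List ℕ}

theorem mono (h : Exec W R M p T Γ Γ' out) (hT : T ≤ T') : Exec W R M p T' Γ Γ' out :=
  fun s hs hmem hR hW =>
    let ⟨t, ht, run⟩ := h s hs hmem hR hW
    ⟨t, ht.trans hT, run⟩

theorem dropVars (h : Exec W R M p T Γ (Γ' ++ Γ'') out) : Exec W R M p T Γ Γ' out := by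
  intro s hs hmem hR hW
  obtain ⟨t, ht, s', run, ptr, vars, mem⟩ := h s hs hmem hR hW
  refine ⟨t, ht, s', run, ptr, fun i hi => ?_, mem⟩
  rw [vars i (by rw [List.length_append]; omega), List.getD_append _ _ _ _ hi]

theorem seq (hp : Exec W R M p T Γ Γ' out) (hq : Exec W R M q T' Γ' Γ'' out') :
    Exec W R M (.seq p q) (T + T') Γ Γ'' (out ++ out') := by
  intro s hs hmem hR hW
  rw [List.length_append] at hR hW
  obtain ⟨t, ht, s₁, run₁, ptr₁, vars₁, mem₁⟩ :=
    hp s hs hmem (fun a ha => by have := hR a ha; omega) (by omega)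
  have hmem₁ : Set.EqOn s₁.mem M R := fun a ha => by
    have := hR a ha
    rw [mem₁, writeList, if_neg (by omega), hmem ha]
  obtain ⟨t', ht', s₂, run₂, ptr₂, vars₂, mem₂⟩ :=
    hq s₁ vars₁ hmem₁ (fun a ha => by have := hR a ha; omega) (by omega)
  refine ⟨t + t', by omega, s₂, .seq run₁ run₂, ?_, vars₂, ?_⟩
  · rw [ptr₂, ptr₁, List.length_append, add_assoc]
  · rw [mem₂, mem₁, ptr₁, writeList_append]

theorem loop_step {r : ℕ} (hr : r < Γ.length) (h0 : Γ.getD r 0 ≠ 0)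
    (h : Exec W R M (.seq p (.loop (r + 1) p)) T Γ Γ' out) :
    Exec W R M (.loop (r + 1) p) (T + 1) Γ Γ' out := by
  intro s hs hmem hR hW
  obtain ⟨t, ht, s', run, post⟩ := h s hs hmem hR hW
  cases run with
  | seq hp hl => exact ⟨_, Nat.succ_le_succ ht, s', .loop_step (by rwa [hs r hr]) hp hl, post⟩

theorem loop {n r : ℕ} {T : ℕ → ℕ} {Γ out : ℕ → List ℕ}
    (hr : ∀ i ≤ n, r < (Γ i).length ∧ (Γ i).getD r 0 = n - i)
    (h : ∀ i < n, Exec W R M p (T i) (Γ i) (Γ (i + 1)) (out i)) :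
    Exec W R M (.loop (r + 1) p) (∑ i ∈ Finset.range n, (T i + 1) + 1) (Γ 0) (Γ n)
      ((List.range n).flatMap out) := by
  induction n generalizing T Γ out with
  | zero =>
    intro s hs _ _ _
    exact ⟨1, by simp, s, .loop_done ((hs r (hr 0 le_rfl).1).trans (hr 0 le_rfl).2), by simp, hs,
      by simp⟩
  | succ n ih =>
    have rest := ih (T := fun i => T (i + 1)) (Γ := fun i => Γ (i + 1))
      (out := fun i => out (i + 1))
      (fun i hi => by simpa [Nat.add_sub_add_right] using hr (i + 1) (by omega))
      (fun i hi => h (i + 1) (by omega))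
    obtain ⟨hr₀, hcount⟩ := hr 0 (Nat.zero_le _)
    rw [List.range_succ_eq_map, List.flatMap_cons, List.flatMap_map, Finset.sum_range_succ']
    exact (((h 0 n.succ_pos).seq rest).loop_step hr₀ (by omega)).mono (by omega)

section Expr
variable {X : ℕ} {e : Expr} (hX : 2 ≤ X) (hM : ∀ a ∈ R, M a < X) (hΓ : ∀ x ∈ Γ, x < X)
  (he : e.Safe X R M Γ) (hW : X ^ e.deg ≤ W)
include hX hM hΓ he hW

theorem push : Exec W R M (e.compile (Γ.length + 1)) e.cost Γ (Γ ++ [e.eval M Γ]) [] := by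
  intro s hs hmem _ _
  obtain ⟨s', run, val, reg, mem⟩ := e.runs_compile hX hΓ hM he hW Γ.length.lt_succ_self hs hmem
  refine ⟨_, le_rfl, s', run, reg 0 (by omega), fun i hi => ?_, by simp [mem]⟩
  rw [List.length_append, List.length_singleton] at hi
  obtain hi | rfl := Nat.lt_succ_iff_lt_or_eq.1 hi
  · rw [reg _ (by omega), hs i hi, List.getD_append _ _ _ _ hi]
  · simp [val]

theorem assign (i : ℕ) :
    Exec W R M (e.assign Γ.length i) (e.cost + 1) Γ (Γ.set i (e.eval M Γ)) [] := by
  intro s hs hmem _ _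
  obtain ⟨s', run, val, reg, mem⟩ := e.runs_compile hX hΓ hM he hW Γ.length.lt_succ_self hs hmem
  have hor : s'.reg (Γ.length + 1) ||| s'.reg (Γ.length + 1) = e.eval M Γ := by
    rw [Nat.or_self, val]
  refine ⟨_, le_rfl, _, .seq run (.instr _ s' ?_), ?_, fun j hj => ?_,
    by simpa [Instr.exec] using mem⟩
  · exact hor.trans_lt ((he.eval_lt hX hΓ hM).trans_le hW)
  · simp [Instr.exec, reg]
  · rw [List.length_set] at hj
    by_cases hij : i = j
    · subst hij
      simpa [Instr.exec, Instr.value, Op.eval, List.getD_eq_getElem?_getD, hj] using hor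
    · simp [Instr.exec, List.getD_eq_getElem?_getD, hij, Ne.symm hij, reg (j + 1) (by omega),
        hs j hj]

theorem emit : Exec W R M (e.emit Γ.length) (e.cost + 3) Γ Γ [e.eval M Γ] := by
  intro s hs hmem _ hlt
  rw [List.length_singleton] at hlt
  obtain ⟨s', run, val, reg, mem⟩ := e.runs_compile hX hΓ hM he hW Γ.length.lt_succ_self hs hmem
  have ptr := reg 0 (by omega)
  refine ⟨_, le_rfl, _, .seq run (.seq (.instr _ _ ?_) (.seq (.instr _ _ ?_) (.instr _ _ ?_))),
    ?_, fun i hi => ?_, ?_⟩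
  · exact val.trans_lt ((he.eval_lt hX hΓ hM).trans_le hW)
  · simp only [Instr.value]; omega
  · simpa [Instr.value, Instr.exec, Op.eval, ptr] using hlt
  · simp [Instr.value, Instr.exec, Op.eval, ptr]
  · simp [Instr.exec, hi.ne, reg (i + 1) (by omega), hs i hi]
  · simp [Instr.exec, Instr.value, writeList_singleton, ptr, val, mem]

theorem ite (h : e.eval M Γ ≠ 0 → Exec W R M p T Γ Γ out) :
    Exec W R M (.seq (e.compile (Γ.length + 1)) (.ite (Γ.length + 1) p .skip)) (e.cost + T + 2) Γ Γ
      (if e.eval M Γ = 0 then [] else out) := by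
  intro s hs hmem hR hlt
  obtain ⟨s₁, run₁, val, reg, mem₁⟩ :=
    e.runs_compile hX hΓ hM he hW Γ.length.lt_succ_self hs hmem
  have ptr₁ := reg 0 (by omega)
  have vars₁ : s₁.HasVars Γ := fun i hi => by rw [reg _ (by omega), hs i hi]
  by_cases h0 : e.eval M Γ = 0
  · exact ⟨e.cost + 2, by omega, s₁, .seq run₁ (.ite_false (val.trans h0) (.skip s₁)),
      by simp [h0, ptr₁], vars₁, by simp [h0, mem₁]⟩
  · rw [if_neg h0] at hR hlt ⊢
    obtain ⟨t, ht, s₂, run₂, ptr₂, vars₂, mem₂⟩ :=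
      h h0 s₁ vars₁ (by rwa [mem₁]) (by rwa [ptr₁]) (by rwa [ptr₁])
    exact ⟨e.cost + (t + 1), by omega, s₂, .seq run₁ (.ite_true (by rwa [val]) run₂),
      by rw [ptr₂, ptr₁], vars₂, by rw [mem₂, mem₁, ptr₁]⟩

end Expr

end Exec

/-! ### Programs that print lists -/

/-- Programs that print a list of numbers, in higher-order abstract syntax: the program in the
scope of a variable is a function of the expression for that variable.  The loop variable of
`loop count init inc body` has the value `init` in the first round and increases by the value of
`inc` after every round. -/
inductive Gen where
  | emit (e : Expr)
  | seq (g h : Gen)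
  | ite (e : Expr) (g : Gen)
  | bind (e : Expr) (g : Expr → Gen)
  | loop (count : Expr) (init : ℕ) (inc : Expr → Expr) (body : Expr → Gen)

namespace Gen

instance : Append Gen := ⟨seq⟩

/-- The loop over `0, …, count - 1`. -/
def forLoop (count : Expr) (body : Expr → Gen) : Gen := loop count 0 (fun _ => 1) body

/-- The machine program, if `k` variables are in use.  A loop keeps the number of the remaining
rounds in a hidden variable in front of the loop variable. -/
def compile : Gen → ℕ → Prog
  | emit e, k => e.emit k
  | seq g h, k => .seq (g.compile k) (h.compile k)
  | ite e g, k => .seq (e.compile (k + 1)) (.ite (k + 1) (g.compile k) .skip)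
  | bind e g, k => .seq (e.compile (k + 1)) ((g (.var k)).compile (k + 1))
  | loop count init inc body, k =>
    .seq (count.compile (k + 1)) (.seq ((Expr.const init).compile (k + 2)) (.loop (k + 1)
      (.seq ((body (.var (k + 1))).compile (k + 2))
        (.seq ((.var (k + 1) + inc (.var (k + 1))).assign (k + 2) (k + 1))
          ((.var k - 1 : Expr).assign (k + 2) k)))))

/-- The value of the loop variable in the round `i` of `n` rounds. -/
def loopVar (M : ℕ → ℕ) (Γ : List ℕ) (n init : ℕ) (inc : Expr → Expr) : ℕ → ℕ
  | 0 => init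
  | i + 1 =>
    let a := loopVar M Γ n init inc i
    a + (inc (.var (Γ.length + 1))).eval M (Γ ++ [n - i, a])

/-- The variables in the round `i` of a loop with `n` rounds. -/
def loopVars (M : ℕ → ℕ) (Γ : List ℕ) (n init : ℕ) (inc : Expr → Expr) (i : ℕ) : List ℕ :=
  Γ ++ [n - i, loopVar M Γ n init inc i]

/-- The printed list. -/
def out (M : ℕ → ℕ) : Gen → List ℕ → List ℕ
  | emit e, Γ => [e.eval M Γ]
  | seq g h, Γ => g.out M Γ ++ h.out M Γ
  | ite e g, Γ => if e.eval M Γ = 0 then [] else g.out M Γ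
  | bind e g, Γ => (g (.var Γ.length)).out M (Γ ++ [e.eval M Γ])
  | loop count init inc body, Γ =>
    (List.range (count.eval M Γ)).flatMap fun i =>
      (body (.var (Γ.length + 1))).out M (loopVars M Γ (count.eval M Γ) init inc i)

/-- An upper bound for the running time of the compiled program, which ignores that the body of a
conditional need not be executed. -/
def time (M : ℕ → ℕ) : Gen → List ℕ → ℕ
  | emit e, _ => e.cost + 3
  | seq g h, Γ => g.time M Γ + h.time M Γ
  | ite e g, Γ => e.cost + g.time M Γ + 2
  | bind e g, Γ => e.cost + (g (.var Γ.length)).time M (Γ ++ [e.eval M Γ])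
  | loop count init inc body, Γ =>
    ∑ i ∈ Finset.range (count.eval M Γ),
      ((body (.var (Γ.length + 1))).time M (loopVars M Γ (count.eval M Γ) init inc i) +
        ((inc (.var (Γ.length + 1))).cost + 8)) + (count.cost + 2)

/-- If the words in memory and the values of the variables are smaller than `X`, then all values
are smaller than `X ^ deg`. -/
def deg : Gen → ℕ → ℕ
  | emit e, _ => e.deg
  | seq g h, k => max (g.deg k) (h.deg k)
  | ite e g, k => max e.deg (g.deg k)
  | bind e g, k => max e.deg ((g (.var k)).deg (k + 1))
  | loop count init inc body, k =>
    max (max count.deg (Expr.const init).deg) (max ((body (.var (k + 1))).deg (k + 2))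
      (max (.var (k + 1) + inc (.var (k + 1))).deg (.var k - 1 : Expr).deg))

/-- All expressions are safe, and the values of all variables are smaller than `X`. -/
def Safe (X : ℕ) (R : Set ℕ) (M : ℕ → ℕ) : Gen → List ℕ → Prop
  | emit e, Γ => e.Safe X R M Γ
  | seq g h, Γ => g.Safe X R M Γ ∧ h.Safe X R M Γ
  | ite e g, Γ => e.Safe X R M Γ ∧ (e.eval M Γ ≠ 0 → g.Safe X R M Γ)
  | bind e g, Γ => e.Safe X R M Γ ∧ e.eval M Γ < X ∧
      (g (.var Γ.length)).Safe X R M (Γ ++ [e.eval M Γ])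
  | loop count init inc body, Γ => count.Safe X R M Γ ∧ count.eval M Γ < X ∧
      (∀ i ≤ count.eval M Γ, loopVar M Γ (count.eval M Γ) init inc i < X) ∧
      ∀ i < count.eval M Γ,
        (inc (.var (Γ.length + 1))).Safe X R M (loopVars M Γ (count.eval M Γ) init inc i) ∧
        (body (.var (Γ.length + 1))).Safe X R M (loopVars M Γ (count.eval M Γ) init inc i)

theorem length_loopVars (M : ℕ → ℕ) (Γ : List ℕ) (n init : ℕ) (inc : Expr → Expr) (i : ℕ) :
    (loopVars M Γ n init inc i).length = Γ.length + 2 := by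
  simp [loopVars]

section Exec
variable {W X : ℕ} {R : Set ℕ} {M : ℕ → ℕ} (hX : 2 ≤ X) (hM : ∀ a ∈ R, M a < X)
include hX hM

theorem exec_loop_round {Γ Δ out : List ℕ} {T n init i : ℕ} {inc : Expr → Expr} {p : Prog}
    (hΔ : Δ = loopVars M Γ n init inc i) (hlt : ∀ x ∈ Δ, x < X)
    (hlt' : loopVar M Γ n init inc (i + 1) < X)
    (hinc : (inc (.var (Γ.length + 1))).Safe X R M Δ)
    (hW : X ^ max (.var (Γ.length + 1) + inc (.var (Γ.length + 1))).deg
      (.var Γ.length - 1 : Expr).deg ≤ W)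
    (hp : Exec W R M p T Δ Δ out) :
    Exec W R M (.seq p (.seq
        ((.var (Γ.length + 1) + inc (.var (Γ.length + 1))).assign (Γ.length + 2) (Γ.length + 1))
        ((.var Γ.length - 1 : Expr).assign (Γ.length + 2) Γ.length)))
      (T + ((inc (.var (Γ.length + 1))).cost + 7)) Δ (loopVars M Γ n init inc (i + 1)) out := by
  have pow_le {m : ℕ} (h : m ≤ _) : X ^ m ≤ W := (Nat.pow_le_pow_right (by omega) h).trans hW
  have hlen : Δ.length = Γ.length + 2 := by rw [hΔ, length_loopVars]
  have hnext : Δ.set (Γ.length + 1) ((.var (Γ.length + 1) + inc (.var (Γ.length + 1))).eval M Δ) =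
      Γ ++ [n - i, loopVar M Γ n init inc (i + 1)] := by
    simp [hΔ, loopVars, loopVar]
  have hlast : (Γ ++ [n - i, loopVar M Γ n init inc (i + 1)]).set Γ.length
      ((.var Γ.length - 1 : Expr).eval M (Γ ++ [n - i, loopVar M Γ n init inc (i + 1)])) =
      loopVars M Γ n init inc (i + 1) := by
    simp [loopVars, Nat.sub_sub]
  have h₁ := Exec.assign hX hM hlt
    (Expr.safe_add.2 ⟨Expr.safe_var.2 (by omega : Γ.length + 1 < Δ.length), hinc⟩)
    (pow_le (le_max_left _ _)) (Γ.length + 1)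
  rw [hlen, hnext] at h₁
  have h₂ := Exec.assign hX hM (Γ := Γ ++ [n - i, loopVar M Γ n init inc (i + 1)])
    (by
      simp only [hΔ, loopVars, List.mem_append, List.mem_cons] at hlt ⊢
      grind)
    (Expr.safe_sub.2 ⟨Expr.safe_var.2 (by simp : Γ.length < _), Expr.safe_ofNat⟩)
    (pow_le (le_max_right _ _)) Γ.length
  rw [hlast, List.length_append, List.length_cons, List.length_singleton] at h₂
  exact List.append_nil out ▸ (hp.seq (h₁.seq h₂)).mono (by simp; omega)

theorem Safe.exec {g : Gen} {Γ : List ℕ} (hg : g.Safe X R M Γ) (hΓ : ∀ x ∈ Γ, x < X)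
    (hW : X ^ g.deg Γ.length ≤ W) :
    Exec W R M (g.compile Γ.length) (g.time M Γ) Γ Γ (g.out M Γ) := by
  induction g generalizing Γ with
  | emit e => exact .emit hX hM hΓ hg hW
  | seq g h ihg ihh =>
    have pow_le {m : ℕ} (h : m ≤ _) : X ^ m ≤ W := (Nat.pow_le_pow_right (by omega) h).trans hW
    exact (ihg hg.1 hΓ (pow_le (le_max_left _ _))).seq (ihh hg.2 hΓ (pow_le (le_max_right _ _)))
  | ite e g ih =>
    have pow_le {m : ℕ} (h : m ≤ _) : X ^ m ≤ W := (Nat.pow_le_pow_right (by omega) h).trans hW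
    exact .ite hX hM hΓ hg.1 (pow_le (le_max_left _ _))
      fun h => ih (hg.2 h) hΓ (pow_le (le_max_right _ _))
  | bind e g ih =>
    have pow_le {m : ℕ} (h : m ≤ _) : X ^ m ≤ W := (Nat.pow_le_pow_right (by omega) h).trans hW
    have body := ih (.var Γ.length) hg.2.2
      (by simpa [or_imp, forall_and] using ⟨hΓ, hg.2.1⟩)
      (by simpa using pow_le (le_max_right _ _))
    rw [List.length_append, List.length_singleton] at body
    exact ((Exec.push hX hM hΓ hg.1 (pow_le (le_max_left _ _))).seq body).dropVars
  | loop count init inc body ih =>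
    have pow_le {m : ℕ} (h : m ≤ _) : X ^ m ≤ W := (Nat.pow_le_pow_right (by omega) h).trans hW
    obtain ⟨hcount, hn, hvar, hround⟩ := hg
    set n := count.eval M Γ
    have vars_lt {i : ℕ} (hi : i ≤ n) : ∀ x ∈ loopVars M Γ n init inc i, x < X := by
      have := hvar i hi
      simp only [loopVars, List.mem_append, List.mem_cons]
      grind
    have push_count := Exec.push hX hM hΓ hcount
      (pow_le ((le_max_left _ _).trans (le_max_left _ _)))
    have push_init := Exec.push (e := .const init) (Γ := Γ ++ [n]) hX hM
      (by simpa [or_imp, forall_and] using ⟨hΓ, hn⟩) trivial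
      (pow_le ((le_max_right _ _).trans (le_max_left _ _)))
    rw [List.length_append, List.length_singleton, List.append_assoc] at push_init
    have rounds := Exec.loop (n := n) (r := Γ.length) (Γ := loopVars M Γ n init inc)
      (fun i _ => by simp [loopVars])
      fun i hi => exec_loop_round hX hM rfl (vars_lt hi.le) (hvar _ hi) (hround i hi).1
        (pow_le ((le_max_right _ _).trans (le_max_right _ _))) (length_loopVars M Γ n init inc i ▸
          ih _ (hround i hi).2 (vars_lt hi.le) (by
            rw [length_loopVars]
            exact pow_le ((le_max_left _ _).trans (le_max_right _ _))))
    exact ((push_count.seq (push_init.seq rounds)).dropVars).mono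
      (by simp only [time, Expr.cost, add_assoc, Nat.reduceAdd, n]; omega)

end Exec

section simpLemmas
variable {X : ℕ} {R : Set ℕ} {M : ℕ → ℕ} {Γ : List ℕ} {e : Expr} {g h : Gen} {body : Expr → Gen}

theorem loopVar_one (n i : ℕ) : loopVar M Γ n 0 (fun _ => 1) i = i := by
  induction i with
  | zero => rfl
  | succ i ih => simp [loopVar, ih]

theorem loopVars_one (n i : ℕ) : loopVars M Γ n 0 (fun _ => 1) i = Γ ++ [n - i, i] := by
  rw [loopVars, loopVar_one]

@[simp] theorem out_append : (g ++ h).out M Γ = g.out M Γ ++ h.out M Γ := rfl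
@[simp] theorem out_emit : (emit e).out M Γ = [e.eval M Γ] := rfl
@[simp] theorem out_ite : (ite e g).out M Γ = if e.eval M Γ = 0 then [] else g.out M Γ := rfl
@[simp] theorem out_bind : (bind e body).out M Γ =
    (body (.var Γ.length)).out M (Γ ++ [e.eval M Γ]) := rfl
@[simp] theorem out_forLoop : (forLoop e body).out M Γ =
    (List.range (e.eval M Γ)).flatMap fun i =>
      (body (.var (Γ.length + 1))).out M (Γ ++ [e.eval M Γ - i, i]) := by
  simp only [forLoop, out, loopVars_one]

@[simp] theorem time_append : (g ++ h).time M Γ = g.time M Γ + h.time M Γ := rfl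
@[simp] theorem time_emit : (emit e).time M Γ = e.cost + 3 := rfl
@[simp] theorem time_ite : (ite e g).time M Γ = e.cost + g.time M Γ + 2 := rfl
@[simp] theorem time_bind : (bind e body).time M Γ =
    e.cost + (body (.var Γ.length)).time M (Γ ++ [e.eval M Γ]) := rfl
@[simp] theorem time_forLoop : (forLoop e body).time M Γ =
    ∑ i ∈ Finset.range (e.eval M Γ),
      ((body (.var (Γ.length + 1))).time M (Γ ++ [e.eval M Γ - i, i]) + 9) + (e.cost + 2) := by
  simp only [forLoop, time, loopVars_one, Expr.cost_ofNat]

@[simp] theorem safe_append : (g ++ h).Safe X R M Γ ↔ g.Safe X R M Γ ∧ h.Safe X R M Γ := .rfl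
@[simp] theorem safe_emit : (emit e).Safe X R M Γ ↔ e.Safe X R M Γ := .rfl
@[simp] theorem safe_ite : (ite e g).Safe X R M Γ ↔
    e.Safe X R M Γ ∧ (e.eval M Γ ≠ 0 → g.Safe X R M Γ) := .rfl
@[simp] theorem safe_bind : (bind e body).Safe X R M Γ ↔ e.Safe X R M Γ ∧ e.eval M Γ < X ∧
    (body (.var Γ.length)).Safe X R M (Γ ++ [e.eval M Γ]) := .rfl
@[simp] theorem safe_forLoop : (forLoop e body).Safe X R M Γ ↔ e.Safe X R M Γ ∧ e.eval M Γ < X ∧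
    ∀ i < e.eval M Γ, (body (.var (Γ.length + 1))).Safe X R M (Γ ++ [e.eval M Γ - i, i]) := by
  simp only [forLoop, Safe, loopVar_one, loopVars_one, Expr.safe_ofNat, true_and]
  exact ⟨fun ⟨he, hlt, _, hbody⟩ => ⟨he, hlt, hbody⟩,
    fun ⟨he, hlt, hbody⟩ => ⟨he, hlt, fun i hi => hi.trans_lt hlt, hbody⟩⟩

end simpLemmas

end Gen

/-! ### Programs that replace the contents of the memory -/

/-- Print a list at the address `b`.  The variable `0` of `g` is that address. -/
def printAt (b : Expr) (g : Gen) : Prog :=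
  .seq (b.compile 1) (.seq (.instr (.op .or 0 1 1)) (g.compile 1))

/-- Print a list at the address `0` and clear the memory behind it.  The new variable `1` of `h`
is the old value of the write pointer, which is also the number of the cleared cells. -/
def printAtZero (h : Gen) : Prog :=
  .seq (.instr (.op .or 2 0 0)) (.seq (.instr (.const 0 0)) (.seq (h.compile 2)
    ((Gen.forLoop (.var 1) fun _ => .emit 0).compile 2)))

/-- Print a list with `g` at the address `b`, replace the contents of the memory by a list that `h`
computes from it, and clear the registers, so that another program can be started. -/
def transform (b : Expr) (g h : Gen) : Prog :=
  .seq (.seq (printAt b g) (printAtZero h))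
    (clearRegs (Prog.seq (printAt b g) (printAtZero h)).regBound)

theorem writeList_replicate_zero {m : ℕ → ℕ} {l : List ℕ} {k : ℕ}
    (h : ∀ a, l.length + k ≤ a → m a = 0) :
    writeList (writeList m 0 l) l.length (.replicate k 0) = (initState l).mem := by
  funext a
  simp only [writeList, initState, List.length_replicate, Nat.zero_add, Nat.zero_le, true_and,
    Nat.sub_zero]
  split_ifs with h₁ h₂
  · rw [List.getD_eq_default l 0 h₁.1, List.getD_eq_getElem?_getD, List.getElem?_replicate]
    split_ifs <;> rfl
  · rfl
  · rw [List.getD_eq_default l 0 (by omega), h a (by omega)]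

theorem initState_mem_lt {X : ℕ} (hX : 0 < X) {l : List ℕ} (hl : ∀ x ∈ l, x < X) (a : ℕ) :
    (initState l).mem a < X := by
  obtain ha | ha := lt_or_ge a l.length
  · exact (List.getD_eq_getElem l 0 ha).trans_lt (hl _ (List.getElem_mem ha))
  · exact (List.getD_eq_default l 0 ha).trans_lt hX

theorem runs_printAt {b : Expr} {g : Gen} {W X B : ℕ} {input tmp : List ℕ} (hX : 2 ≤ X)
    (hWb : X ^ b.deg ≤ W) (hWg : X ^ g.deg 1 ≤ W) (hinput : ∀ x ∈ input, x < X) (hBX : B < X)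
    (hb : b.Safe X Set.univ (initState input).mem [])
    (hB : b.eval (initState input).mem [] = B)
    (hg : g.Safe X (Set.Iio B) (initState input).mem [B])
    (hout : g.out (initState input).mem [B] = tmp) (hlt : B + tmp.length < W) :
    ∃ t ≤ b.cost + 1 + g.time (initState input).mem [B], ∃ s,
      Runs W (printAt b g) (initState input) t s ∧
      s.reg 0 = B + tmp.length ∧ s.reg 1 = B ∧
      s.mem = writeList (initState input).mem B tmp := by
  subst hout
  have input_lt := initState_mem_lt (by omega) hinput
  obtain ⟨s₁, run₁, val₁, -, mem₁⟩ := b.runs_compile hX (Γ := []) (by simp) (fun a _ => input_lt a)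
    hb hWb zero_lt_one (s := initState input) (by simp [State.HasVars]) (Set.eqOn_refl _ _)
  have hor : s₁.reg 1 ||| s₁.reg 1 = B := by rw [Nat.or_self, val₁, hB]
  obtain ⟨t, ht, s₂, run₂, ptr₂, vars₂, mem₂⟩ := hg.exec hX (fun a _ => input_lt a) (by simpa) hWg
    ((Instr.op .or 0 1 1).exec s₁)
    (by simpa [State.HasVars, Instr.exec] using val₁.trans hB) (fun a _ => congrFun mem₁ a)
    (fun a ha => .inl (by simpa [Instr.exec, Instr.value, Op.eval, hor] using ha))
    (by simpa [Instr.exec, Instr.value, Op.eval, hor] using hlt)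
  refine ⟨_, ?_, s₂, .seq run₁ (.seq (.instr _ _ (hor.trans_lt (by omega))) run₂), ?_, ?_, ?_⟩
  · omega
  · simpa [Instr.exec, Instr.value, Op.eval, hor] using ptr₂
  · simpa using vars₂ 0 (by simp)
  · rw [mem₂]
    simp [Instr.exec, Instr.value, Op.eval, hor, mem₁]

theorem runs_printAtZero {h : Gen} {W X B E : ℕ} {M : ℕ → ℕ} {output : List ℕ} {s : State}
    (hX : 2 ≤ X) (hWh : X ^ h.deg 2 ≤ W) (hWX : X ^ 3 ≤ W) (hM : ∀ a ∈ Set.Ico B E, M a < X)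
    (hmem : Set.EqOn s.mem M (Set.Ico B E)) (hE : s.reg 0 = E) (hB : s.reg 1 = B)
    (hBE : B ≤ E) (hEX : E < X)
    (hh : h.Safe X (Set.Ico B E) M [B, E]) (hout : h.out M [B, E] = output)
    (hlen : output.length ≤ B)
    (h0 : ∀ a, E ≤ a → s.mem a = 0) :
    ∃ t ≤ h.time M [B, E] + 13 * E + 5, ∃ s', Runs W (printAtZero h) s t s' ∧
      s'.mem = (initState output).mem := by
  subst hout
  have hΓ : ∀ x ∈ [B, E], x < X := by
    simp only [List.mem_cons, List.not_mem_nil, or_false, forall_eq_or_imp, forall_eq]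
    omega
  have two_mul_le : 2 * X ≤ W := le_trans (by nlinarith [sq_nonneg X]) hWX
  have hor : s.reg 0 ||| s.reg 0 = E := by rw [Nat.or_self, hE]
  let s₀ := (Instr.const 0 0).exec ((Instr.op .or 2 0 0).exec s)
  have vars₀ : s₀.HasVars [B, E] := by
    intro i hi
    simp only [List.length_cons, List.length_nil] at hi
    interval_cases i <;> simp [s₀, Instr.exec, Instr.value, Op.eval, hB, hor]
  have ptr₀ : s₀.reg 0 = 0 := by simp [s₀, Instr.exec, Instr.value]
  obtain ⟨t₁, ht₁, s₁, run₁, ptr₁, vars₁, mem₁⟩ := hh.exec hX hM hΓ hWh s₀ vars₀ hmem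
    (fun a ha => .inr (by have := ha.1; omega)) (by omega)
  have zeros : (Gen.forLoop (.var 1) fun _ => .emit 0).Safe X ∅ M [B, E] := by simpa using hEX
  obtain ⟨t₂, ht₂, s₂, run₂, -, -, mem₂⟩ := zeros.exec hX (by simp) hΓ
    hWX s₁ vars₁ (by simp) (by simp)
    (by simp [ptr₁, ptr₀]; omega)
  refine ⟨_, ?_, s₂, .seq (.instr _ _ (hor.trans_lt (by omega)))
    (.seq (.instr _ _ (by simp only [Instr.value]; omega)) (.seq run₁ run₂)), ?_⟩
  · simp at ht₂
    omega
  · have hout : (Gen.forLoop (.var 1) fun _ => .emit 0).out M [B, E] = List.replicate E 0 := by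
      simp [← List.map_eq_flatMap]
    rw [mem₂, ptr₁, mem₁, ptr₀, Nat.zero_add, hout, writeList_replicate_zero]
    exact fun a ha => h0 a (by omega)

/-- The exponent of the word bound and the factor of the running time in `runs_transform`. -/
def transformConst (b : Expr) (g h : Gen) : ℕ :=
  b.deg + g.deg 1 + h.deg 2 + b.cost + (transform b g h).regBound + 40

theorem runs_transform {b : Expr} {g h : Gen} {W X B : ℕ} {input tmp output : List ℕ}
    (hX : 2 ≤ X) (hW : X ^ transformConst b g h ≤ W) (hinput : ∀ x ∈ input, x < X)
    (htmp : ∀ x ∈ tmp, x < X) (hBX : 2 * B < X) (input_le : input.length ≤ B)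
    (tmp_le : tmp.length ≤ B) (output_le : output.length ≤ B)
    (hb : b.eval (initState input).mem [] = B)
    (hbs : b.Safe X Set.univ (initState input).mem [])
    (hg : g.out (initState input).mem [B] = tmp)
    (hgs : g.Safe X (Set.Iio B) (initState input).mem [B])
    (hh : h.out (fun a => (initState tmp).mem (a - B)) [B, B + tmp.length] = output)
    (hhs : h.Safe X (Set.Ico B (B + tmp.length)) (fun a => (initState tmp).mem (a - B))
      [B, B + tmp.length]) :
    ∃ t ≤ g.time (initState input).mem [B] +
        h.time (fun a => (initState tmp).mem (a - B)) [B, B + tmp.length] +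
        transformConst b g h * (B + 1),
      Runs W (transform b g h) (initState input) t (initState output) := by
  have pow_le {m : ℕ} (h : m ≤ _) : X ^ m ≤ W := (Nat.pow_le_pow_right (by omega) h).trans hW
  have le_W : X ^ 2 ≤ W := pow_le (by simp only [transformConst]; omega)
  obtain ⟨t₁, ht₁, s₁, run₁, ptr₁, var₁, mem₁⟩ := runs_printAt hX
    (pow_le (by simp only [transformConst]; omega)) (pow_le (by simp only [transformConst]; omega))
    hinput (by omega) hbs hb hgs hg ((by nlinarith : B + tmp.length < X ^ 2).trans_le le_W)
  obtain ⟨t₂, ht₂, s₂, run₂, mem₂⟩ := runs_printAtZero hX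
    (pow_le (by simp only [transformConst]; omega)) (pow_le (by simp only [transformConst]; omega))
    (fun a _ => initState_mem_lt (by omega) htmp (a - B))
    (fun a ha => by rw [mem₁]; exact if_pos ha) ptr₁ var₁ (by omega) (by omega) hhs
    hh output_le (fun a ha => by
      rw [mem₁, writeList, if_neg (by omega)]
      exact List.getD_eq_default _ _ (by omega))
  have final : (⟨fun r => if r < (Prog.seq (printAt b g) (printAtZero h)).regBound then 0
      else s₂.reg r, s₂.mem⟩ : State) = initState output := by
    rw [mem₂]
    congr 1
    funext r
    split_ifs with hr
    · rfl
    · exact (run₁.seq run₂).reg_eq (not_lt.1 hr)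
  have W_pos : 0 < W := (Nat.pow_pos (by omega)).trans_le le_W
  refine ⟨_, ?_, final ▸ (run₁.seq run₂).seq (runs_clearRegs W_pos _ s₂)⟩
  have hreg : (Prog.seq (printAt b g) (printAtZero h)).regBound ≤ (transform b g h).regBound :=
    le_max_left _ _
  have hconst : b.cost + (transform b g h).regBound + 40 ≤ transformConst b g h := by
    rw [transformConst]
    omega
  have : 39 * B + transformConst b g h ≤ transformConst b g h * (B + 1) := by nlinarith
  omega

end WordRAM

/-! ### Distances in weighted graphs -/

namespace WeightedGraph
variable {V : Type*} (G : WeightedGraph V)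

/-- There is a walk of length at most `k`, that is, the distance is at most `k`. -/
def Near (u v : V) (k : ℕ) : Prop := ∃ p : G.graph.Walk u v, G.walkLength p ≤ k

variable {G}

theorem Near.dist_le {u v : V} {k : ℕ} (h : G.Near u v k) : G.dist u v ≤ k :=
  let ⟨p, hp⟩ := h
  (iInf_le _ p).trans (by exact_mod_cast hp)

theorem Near.mono {u v : V} {k k' : ℕ} (h : G.Near u v k) (hk : k ≤ k') : G.Near u v k' :=
  let ⟨p, hp⟩ := h
  ⟨p, hp.trans hk⟩

theorem Near.refl (u : V) (k : ℕ) : G.Near u u k := ⟨.nil, by simp [walkLength]⟩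

theorem Near.symm {u v : V} {k : ℕ} (h : G.Near u v k) : G.Near v u k :=
  let ⟨p, hp⟩ := h
  ⟨p.reverse, by simpa [walkLength, List.map_reverse] using hp⟩

theorem Near.trans {u v w : V} {k k' : ℕ} (h : G.Near u v k) (h' : G.Near v w k') :
    G.Near u w (k + k') := by
  obtain ⟨p, hp⟩ := h
  obtain ⟨q, hq⟩ := h'
  refine ⟨p.append q, ?_⟩
  simp only [walkLength, SimpleGraph.Walk.edges_append, List.map_append, List.sum_append] at *
  omega

theorem Near.of_adj {u v : V} (h : G.graph.Adj u v) : G.Near u v (G.weight s(u, v)) :=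
  ⟨.cons h .nil, by simp [walkLength]⟩

theorem le_add_walkLength {φ : V → ℕ}
    (hφ : ∀ u v, G.graph.Adj u v → φ v ≤ φ u + G.weight s(u, v)) {u v : V}
    (p : G.graph.Walk u v) : φ v ≤ φ u + G.walkLength p := by
  induction p with
  | nil => simp
  | cons h p ih =>
    have := hφ _ _ h
    simp only [walkLength, SimpleGraph.Walk.edges_cons, List.map_cons, List.sum_cons] at ih ⊢
    omega

theorem le_dist_of_potential {φ : V → ℕ}
    (hφ : ∀ u v, G.graph.Adj u v → φ v ≤ φ u + G.weight s(u, v)) {u v : V} (hu : φ u = 0) :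
    (φ v : ℕ∞) ≤ G.dist u v :=
  le_iInf fun p => by
    have := le_add_walkLength hφ p
    rw [hu, zero_add] at this
    exact_mod_cast this

/-- The graph with a given list of weighted edges. -/
def ofEdges [DecidableEq V] (L : List (V × V × ℕ)) : WeightedGraph V where
  graph := .fromEdgeSet {e | e ∈ L.map fun e => s(e.1, e.2.1)}
  weight e := ((L.find? fun x => s(x.1, x.2.1) = e).map fun x => x.2.2).getD 0

end WeightedGraph

theorem isEdgeList_ofEdges {n : ℕ} {L : List (Fin n × Fin n × ℕ)}
    (hL : (L.map fun e => s(e.1, e.2.1)).Nodup) (hne : ∀ e ∈ L, e.1 ≠ e.2.1) :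
    IsEdgeList (WeightedGraph.ofEdges L) L := by
  refine ⟨hL, fun e => ?_, fun e he => ?_⟩
  · simp only [WeightedGraph.ofEdges, SimpleGraph.edgeSet_fromEdgeSet, Set.mem_sdiff,
      Set.mem_ofPred_eq, and_iff_left_iff_imp]
    intro h
    obtain ⟨x, hx, rfl⟩ := List.mem_map.1 h
    simpa using hne x hx
  · obtain ⟨x, hx⟩ : ∃ x, L.find? (fun x => s(x.1, x.2.1) = s(e.1, e.2.1)) = some x := by
      rw [← Option.isSome_iff_exists, List.find?_isSome]
      exact ⟨e, he, by simp⟩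
    have hsym : s(x.1, x.2.1) = s(e.1, e.2.1) := by simpa using List.find?_some hx
    have hxe := List.inj_on_of_nodup_map hL (List.mem_of_find?_eq_some hx) he hsym
    change ((L.find? fun x => s(x.1, x.2.1) = s(e.1, e.2.1)).map fun x => x.2.2).getD 0 = e.2.2
    rw [hx, hxe]
    rfl

/-- A list of weighted edges, with the vertices replaced by their numbers. -/
def numberEdges {V : Type*} {N : ℕ} (number : V ≃ Fin N) (L : List (V × V × ℕ)) :
    List (Fin N × Fin N × ℕ) :=
  L.map fun e => (number e.1, number e.2.1, e.2.2)

theorem isEdgeList_numberEdges {V : Type*} {N : ℕ} {number : V ≃ Fin N} {L : List (V × V × ℕ)}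
    (hL : (L.map fun e => s(e.1, e.2.1)).Nodup) (hne : ∀ e ∈ L, e.1 ≠ e.2.1) :
    IsEdgeList (WeightedGraph.ofEdges (numberEdges number L)) (numberEdges number L) := by
  apply isEdgeList_ofEdges
  · simpa [numberEdges, Function.comp_def] using hL.map (Sym2.map.injective number.injective)
  · intro e he
    obtain ⟨x, hx, rfl⟩ := List.mem_map.1 he
    exact number.injective.ne (hne x hx)

namespace IsEdgeList
variable {n : ℕ} {G : WeightedGraph (Fin n)} {L : List (Fin n × Fin n × ℕ)} (h : IsEdgeList G L)
include h

theorem near {u v : Fin n} {w : ℕ} (he : (u, v, w) ∈ L) : G.Near u v w := by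
  have adj : G.graph.Adj u v := (h.2.1 s(u, v)).2 (List.mem_map.2 ⟨_, he, rfl⟩)
  have weight_eq : G.weight s(u, v) = w := h.2.2 _ he
  exact weight_eq ▸ WeightedGraph.Near.of_adj adj

theorem weightsOneOrTwo (hw : ∀ e ∈ L, e.2.2 = 1 ∨ e.2.2 = 2) : G.WeightsOneOrTwo := by
  intro e he
  obtain ⟨x, hx, rfl⟩ := List.mem_map.1 ((h.2.1 e).1 he)
  rw [h.2.2 x hx]
  exact hw x hx

theorem le_dist_of_potential {φ : Fin n → ℕ}
    (hφ : ∀ e ∈ L, φ e.1 ≤ φ e.2.1 + e.2.2 ∧ φ e.2.1 ≤ φ e.1 + e.2.2) {u v : Fin n}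
    (hu : φ u = 0) : (φ v : ℕ∞) ≤ G.dist u v := by
  refine WeightedGraph.le_dist_of_potential (fun u v huv => ?_) hu
  obtain ⟨x, hx, hs⟩ := List.mem_map.1 ((h.2.1 s(u, v)).1 huv)
  rw [← hs, h.2.2 x hx]
  rcases Sym2.eq_iff.1 hs with ⟨rfl, rfl⟩ | ⟨rfl, rfl⟩
  exacts [(hφ x hx).2, (hφ x hx).1]

end IsEdgeList

/-! ### The graph of a `3`-OV instance -/

/-- The two sides of the graph belong to the families `0` and `2`. -/
def sideFamily (σ : Fin 2) : Fin 3 := ⟨2 * σ, by omega⟩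

/-- The vertices of the graph of a `3`-OV instance.  Every vector `g = (σ, a)` of the family of the
side `σ` has an anchor, a hub, a vertex `pair g b` for every vector `b` of the middle family, and a
vertex `coords g x y` for every pair of coordinates.  The number `q` of the leaves at the center is
arbitrary, since leaves only serve to make the graph sparse. -/
inductive OVVertex (n d q : ℕ) where
  | center
  | leaf (i : Fin q)
  | anchor (g : Fin 2 × Fin n)
  | hub (g : Fin 2 × Fin n)
  | pair (g : Fin 2 × Fin n) (b : Fin n)
  | coords (g : Fin 2 × Fin n) (x y : Fin d)

namespace OVInstance
open OVVertex
variable {n d : ℕ} (I : OVInstance 3 n d) (q : ℕ)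

/-- The condition for an edge between `pair g b` and `coords g x y`. -/
def PairAdj (g : Fin 2 × Fin n) (b : Fin n) (x y : Fin d) : Prop :=
  I (sideFamily g.1) g.2 x ∧ I (sideFamily g.1) g.2 y ∧ I 1 b x

/-- The condition for an edge between `coords (0, a) x y` and `coords (1, c) y x`. -/
def CoordsAdj (a c : Fin n) (x y : Fin d) : Prop :=
  I 0 a x ∧ I 0 a y ∧ I 2 c x ∧ I 2 c y

instance (g : Fin 2 × Fin n) (b : Fin n) (x y : Fin d) : Decidable (I.PairAdj g b x y) :=
  inferInstanceAs (Decidable (_ ∧ _))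

instance (a c : Fin n) (x y : Fin d) : Decidable (I.CoordsAdj a c x y) :=
  inferInstanceAs (Decidable (_ ∧ _))

/-- The weighted edges of the graph of a `3`-OV instance. -/
inductive Edge : OVVertex n d q × OVVertex n d q × ℕ → Prop
  | center_leaf (i : Fin q) : Edge (center, leaf i, 1)
  | anchor_hub (g : Fin 2 × Fin n) : Edge (anchor g, hub g, 1)
  | center_hub (g : Fin 2 × Fin n) : Edge (center, hub g, 2)
  | anchor_anchor (σ : Fin 2) (a a' : Fin n) (h : a' < a) :
      Edge (anchor (σ, a), anchor (σ, a'), 2)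
  | anchor_pair (g : Fin 2 × Fin n) (b : Fin n) : Edge (anchor g, pair g b, 2)
  | hub_coords (g : Fin 2 × Fin n) (x y : Fin d) : Edge (hub g, coords g x y, 1)
  | pair_coords (g : Fin 2 × Fin n) (b : Fin n) (x y : Fin d) (h : I.PairAdj g b x y) :
      Edge (pair g b, coords g x y, 2)
  | coords_coords (a c : Fin n) (x y : Fin d) (h : I.CoordsAdj a c x y) :
      Edge (coords (0, a) x y, coords (1, c) y x, 2)

variable (n) in
/-- The vectors of the two outer families. -/
def outerVectors : List (Fin 2 × Fin n) := List.finRange 2 ×ˢ List.finRange n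

variable (d) in
/-- The pairs of coordinates. -/
def coordPairs : List (Fin d × Fin d) := List.finRange d ×ˢ List.finRange d

/-- The list of the edges of the graph of a `3`-OV instance. -/
def edges : List (OVVertex n d q × OVVertex n d q × ℕ) :=
  ((List.finRange q).map fun i => (center, leaf i, 1)) ++
  (((outerVectors n).map fun g => (anchor g, hub g, 1)) ++
  (((outerVectors n).map fun g => (center, hub g, 2)) ++
  ((((outerVectors n ×ˢ List.finRange n).filter fun (g, a) => a < g.2).map
    fun (g, a) => (anchor g, anchor (g.1, a), 2)) ++
  (((outerVectors n ×ˢ List.finRange n).map fun (g, b) => (anchor g, pair g b, 2)) ++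
  (((outerVectors n ×ˢ coordPairs d).map fun (g, x, y) => (hub g, coords g x y, 1)) ++
  ((((outerVectors n ×ˢ (List.finRange n ×ˢ coordPairs d)).filter
    fun (g, b, x, y) => I.PairAdj g b x y).map
    fun (g, b, x, y) => (pair g b, coords g x y, 2)) ++
  ((List.finRange n ×ˢ (List.finRange n ×ˢ coordPairs d)).filter
    fun (a, c, x, y) => I.CoordsAdj a c x y).map
    fun (a, c, x, y) => (coords (0, a) x y, coords (1, c) y x, 2)))))))

variable {I q}

theorem mem_edges {e : OVVertex n d q × OVVertex n d q × ℕ} : e ∈ I.edges q ↔ I.Edge q e := by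
  simp only [edges, outerVectors, coordPairs, List.mem_append, List.mem_map, List.mem_filter,
    List.mem_product, List.mem_finRange, Prod.exists, true_and, decide_eq_true_eq]
  constructor
  · rintro (⟨i, rfl⟩ | ⟨σ, a, rfl⟩ | ⟨σ, a, rfl⟩ | ⟨σ, a, a', h, rfl⟩ | ⟨σ, a, b, rfl⟩ |
      ⟨σ, a, x, y, rfl⟩ | ⟨σ, a, b, x, y, h, rfl⟩ | ⟨a, c, x, y, h, rfl⟩)
    · exact .center_leaf i
    · exact .anchor_hub _
    · exact .center_hub _
    · exact .anchor_anchor σ a a' h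
    · exact .anchor_pair _ b
    · exact .hub_coords _ x y
    · exact .pair_coords _ b x y h
    · exact .coords_coords a c x y h
  · rintro (i | ⟨σ, a⟩ | ⟨σ, a⟩ | ⟨σ, a, a', h⟩ | ⟨⟨σ, a⟩, b⟩ | ⟨⟨σ, a⟩, x, y⟩ |
      ⟨⟨σ, a⟩, b, x, y, h⟩ | ⟨a, c, x, y, h⟩) <;> simp_all

theorem nodup_edges : (I.edges q).Nodup := by
  have outer : (outerVectors n).Nodup := (List.nodup_finRange 2).product (List.nodup_finRange n)
  have coord : (coordPairs d).Nodup := (List.nodup_finRange d).product (List.nodup_finRange d)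
  have fin := List.nodup_finRange n
  refine .append (.map ?_ (List.nodup_finRange q)) (.append (.map ?_ outer)
    (.append (.map ?_ outer) (.append (.map ?_ (.filter _ (.product outer fin)))
      (.append (.map ?_ (.product outer fin)) (.append (.map ?_ (.product outer coord))
        (.append (.map ?_ (.filter _ (.product outer (.product fin coord))))
          (.map ?_ (.filter _ (.product fin (.product fin coord)))) ?_) ?_) ?_) ?_) ?_) ?_) ?_
  all_goals first
    | (intro x y; simp only [Prod.mk.injEq, leaf.injEq, hub.injEq]; grind)
    | (intro e; simp only [List.mem_append, List.mem_map]; grind)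

theorem Edge.ne {e : OVVertex n d q × OVVertex n d q × ℕ} (h : I.Edge q e) : e.1 ≠ e.2.1 := by
  cases h <;> simp; grind

theorem Edge.one_or_two {e : OVVertex n d q × OVVertex n d q × ℕ} (h : I.Edge q e) :
    e.2.2 = 1 ∨ e.2.2 = 2 := by
  cases h <;> simp

theorem nodup_edges_sym2 : ((I.edges q).map fun e => s(e.1, e.2.1)).Nodup := by
  refine nodup_edges.map_on fun x hx y hy hxy => ?_
  rw [mem_edges] at hx hy
  cases hx <;> cases hy <;> simp_all
  grind

/-! ### Distances in the graph of a `3`-OV instance -/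

theorem hasSolution_iff :
    I.HasSolution ↔ ∃ a b c, ∀ x, ¬(I 0 a x ∧ I 1 b x ∧ I 2 c x) := by
  simp only [HasSolution, Finset.sum_eq_zero_iff, Finset.mem_univ, true_imp_iff,
    Fin.prod_univ_three, mul_eq_zero, Bool.toNat_eq_zero]
  constructor
  · rintro ⟨f, hf⟩
    exact ⟨f 0, f 1, f 2, fun x => by have := hf x; grind⟩
  · rintro ⟨a, b, c, h⟩
    exact ⟨![a, b, c], fun x => by have := h x; simp; grind⟩

variable (I) in
/-- If `a`, `b`, `c` is a solution, then the potential is a lower bound for the distance from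
`pair (0, a) b`, and `pair (1, c) b` has potential `10`. -/
def potential (a b c : Fin n) : OVVertex n d q → ℕ
  | center => 5
  | leaf _ => 5
  | anchor g => if g.1 = 0 then (if g.2 = a then 2 else 4) else if g.2 = c then 8 else 6
  | hub g => if g.1 = 0 then (if g.2 = a then 3 else 5) else if g.2 = c then 7 else 5
  | pair g b' =>
    if g.1 = 0 then (if g.2 = a then (if b' = b then 0 else 4) else 6)
    else if g.2 = c then (if b' = b then 10 else 6) else 4
  | coords g x y =>
    if g.1 = 0 then (if g.2 = a then (if I.PairAdj g b x y then 2 else 4) else 6)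
    else if g.2 = c then (if I.PairAdj g b x y then 8 else 6) else 4

theorem Edge.potential {a b c : Fin n} (hs : ∀ x, ¬(I 0 a x ∧ I 1 b x ∧ I 2 c x))
    {e : OVVertex n d q × OVVertex n d q × ℕ} (h : I.Edge q e) :
    I.potential a b c e.1 ≤ I.potential a b c e.2.1 + e.2.2 ∧
      I.potential a b c e.2.1 ≤ I.potential a b c e.1 + e.2.2 := by
  rcases h with i | g | g | ⟨σ, a₁, a₂, h⟩ | ⟨g, b'⟩ | ⟨g, x, y⟩ | ⟨g, b', x, y, h⟩ |
    ⟨a₁, c₁, x, y, h⟩ <;> simp only [OVInstance.potential]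
  · simp
  · split_ifs <;> simp
  · split_ifs <;> simp
  · split_ifs <;> simp
  · split_ifs <;> simp
  · split_ifs <;> simp
  · split_ifs <;> simp_all
  · -- The potentials are too far apart only if `a₁ = a`, `c₁ = c` and `b` has a one at `x` or `y`,
    -- which is then a common one of `a`, `b` and `c`.
    have hx := hs x
    have hy := hs y
    clear hs
    simp only [CoordsAdj] at h
    by_cases h₁ : a₁ = a <;> by_cases h₂ : c₁ = c <;> by_cases h₃ : I 1 b x <;>
      by_cases h₄ : I 1 b y <;> simp_all [PairAdj, sideFamily]

section Near
variable {W : Type*} {G : WeightedGraph W} {code : OVVertex n d q → W}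
  (hG : ∀ u v w, I.Edge q (u, v, w) → G.Near (code u) (code v) w)
include hG

theorem near_center_anchor (g : Fin 2 × Fin n) : G.Near (code center) (code (anchor g)) 3 :=
  (hG _ _ _ (.center_hub g)).trans (hG _ _ _ (.anchor_hub g)).symm

theorem near_anchor_anchor (σ : Fin 2) (a a' : Fin n) :
    G.Near (code (anchor (σ, a))) (code (anchor (σ, a'))) 2 := by
  rcases lt_trichotomy a a' with h | rfl | h
  · exact (hG _ _ _ (.anchor_anchor _ _ _ h)).symm
  · exact .refl _ _
  · exact hG _ _ _ (.anchor_anchor _ _ _ h)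

theorem near_center_or_near_anchor (u : OVVertex n d q) : G.Near (code u) (code center) 1 ∨
    ∃ (g : Fin 2 × Fin n) (b : Fin n), G.Near (code u) (code (anchor g)) 2 ∧
      ∀ x y, I.PairAdj g b x y → G.Near (code u) (code (coords g x y)) 2 := by
  have anchor_hub (g) := hG _ _ _ (.anchor_hub g)
  have hub_coords (g x y) := hG _ _ _ (.hub_coords g x y)
  cases u with
  | center => exact .inl (.refl _ _)
  | leaf i => exact .inl (hG _ _ _ (.center_leaf i)).symm
  | anchor g =>
    exact .inr ⟨g, g.2, .refl _ _, fun x y _ => (anchor_hub g).trans (hub_coords g x y)⟩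
  | hub g =>
    exact .inr ⟨g, g.2, (anchor_hub g).symm.mono (by simp),
      fun x y _ => (hub_coords g x y).mono (by simp)⟩
  | pair g b =>
    exact .inr ⟨g, b, (hG _ _ _ (.anchor_pair g b)).symm,
      fun x y h => hG _ _ _ (.pair_coords g b x y h)⟩
  | coords g x y =>
    exact .inr ⟨g, g.2, (hub_coords g x y).symm.trans (anchor_hub g).symm,
      fun x' y' _ => (hub_coords g x y).symm.trans (hub_coords g x' y')⟩

theorem near_center (u : OVVertex n d q) : G.Near (code u) (code center) 5 := by
  rcases near_center_or_near_anchor hG u with h | ⟨g, b, h, -⟩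
  · exact h.mono (by simp)
  · exact h.trans (near_center_anchor hG g).symm

theorem near_of_not_hasSolution (hI : ¬I.HasSolution) (u v : OVVertex n d q) :
    G.Near (code u) (code v) 6 := by
  rcases near_center_or_near_anchor hG u with hu | ⟨⟨σ, a⟩, b, hu, hu'⟩
  · exact hu.trans (near_center hG v).symm
  rcases near_center_or_near_anchor hG v with hv | ⟨⟨τ, c⟩, b', hv, hv'⟩
  · exact (near_center hG u).trans hv.symm
  by_cases hστ : σ = τ
  · subst hστ
    exact (hu.trans (near_anchor_anchor hG σ a c)).trans hv.symm
  rw [hasSolution_iff] at hI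
  push Not at hI
  have opposite_sides {u v : OVVertex n d q} {a b c b' : Fin n}
      (hu : ∀ x y, I.PairAdj (0, a) b x y → G.Near (code u) (code (coords (0, a) x y)) 2)
      (hv : ∀ x y, I.PairAdj (1, c) b' x y → G.Near (code v) (code (coords (1, c) x y)) 2) :
      G.Near (code u) (code v) 6 := by
    obtain ⟨x, hxa, hxb, hxc⟩ := hI a b c
    obtain ⟨y, hya, hyb, hyc⟩ := hI a b' c
    exact ((hu x y ⟨hxa, hya, hxb⟩).trans (hG _ _ _
      (.coords_coords a c x y ⟨hxa, hya, hxc, hyc⟩))).trans (hv y x ⟨hyc, hxc, hyb⟩).symm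
  have sides : (σ = 0 ∧ τ = 1) ∨ (σ = 1 ∧ τ = 0) := by omega
  rcases sides with ⟨rfl, rfl⟩ | ⟨rfl, rfl⟩
  · exact opposite_sides hu' hv'
  · exact (opposite_sides hv' hu').symm

end Near

end OVInstance

namespace OVVertex
variable {n d q : ℕ}

/-- The vertices as a sum type. -/
def equivSum (n d q : ℕ) : OVVertex n d q ≃
    (Fin 1 ⊕ Fin q) ⊕ ((Fin 2 × Fin n ⊕ Fin 2 × Fin n) ⊕
      ((Fin 2 × Fin n) × Fin n ⊕ ((Fin 2 × Fin n) × Fin d) × Fin d)) where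
  toFun
    | center => .inl (.inl 0)
    | leaf i => .inl (.inr i)
    | anchor g => .inr (.inl (.inl g))
    | hub g => .inr (.inl (.inr g))
    | pair g b => .inr (.inr (.inl (g, b)))
    | coords g x y => .inr (.inr (.inr ((g, x), y)))
  invFun
    | .inl (.inl _) => center
    | .inl (.inr i) => leaf i
    | .inr (.inl (.inl g)) => anchor g
    | .inr (.inl (.inr g)) => hub g
    | .inr (.inr (.inl (g, b))) => pair g b
    | .inr (.inr (.inr ((g, x), y))) => coords g x y
  left_inv u := by cases u <;> rfl
  right_inv u := by
    rcases u with (i | _) | (_ | _) | ⟨_, _⟩ | ⟨⟨_, _⟩, _⟩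
    · simp [Subsingleton.elim i 0]
    all_goals rfl

/-- The number of vertices. -/
abbrev count (n d q : ℕ) : ℕ := 1 + q + (2 * n + 2 * n + (2 * n * n + 2 * n * d * d))

/-- The numbering of the vertices by which they are printed. -/
def number (n d q : ℕ) : OVVertex n d q ≃ Fin (count n d q) :=
  let vector : Fin 2 × Fin n ≃ Fin (2 * n) := finProdFinEquiv
  let pair := (vector.prodCongr (.refl _)).trans finProdFinEquiv
  let coords := (((vector.prodCongr (.refl _)).trans finProdFinEquiv).prodCongr (.refl _)).trans
    finProdFinEquiv
  (equivSum n d q).trans <| (finSumFinEquiv.sumCongr <| (((vector.sumCongr vector).trans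
    finSumFinEquiv).sumCongr ((pair.sumCongr coords).trans finSumFinEquiv)).trans
    finSumFinEquiv).trans finSumFinEquiv

theorem val_number_center : (number n d q center : ℕ) = 0 := rfl

theorem val_number_leaf (i : Fin q) : (number n d q (leaf i) : ℕ) = 1 + i := rfl

theorem val_number_anchor (g : Fin 2 × Fin n) :
    (number n d q (anchor g) : ℕ) = 1 + q + (g.2 + n * g.1) := rfl

theorem val_number_hub (g : Fin 2 × Fin n) :
    (number n d q (hub g) : ℕ) = 1 + q + (2 * n + (g.2 + n * g.1)) := rfl

theorem val_number_pair (g : Fin 2 × Fin n) (b : Fin n) :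
    (number n d q (pair g b) : ℕ) = 1 + q + (2 * n + 2 * n + (b + n * (g.2 + n * g.1))) := rfl

theorem val_number_coords (g : Fin 2 × Fin n) (x y : Fin d) :
    (number n d q (coords g x y) : ℕ) =
      1 + q + (2 * n + 2 * n + (2 * n * n + (y + d * (x + d * (g.2 + n * g.1))))) := rfl

end OVVertex

namespace OVInstance
open OVVertex
variable {n d : ℕ} (I : OVInstance 3 n d) (q : ℕ)

/-- The edges of the graph between the numbers of the vertices. -/
def edgeList : List (Fin (count n d q) × Fin (count n d q) × ℕ) :=
  numberEdges (number n d q) (I.edges q)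

/-- The graph of a `3`-OV instance, on the numbers of the vertices. -/
def graph : WeightedGraph (Fin (count n d q)) := .ofEdges (I.edgeList q)

theorem isEdgeList_graph : IsEdgeList (I.graph q) (I.edgeList q) :=
  isEdgeList_numberEdges nodup_edges_sym2 fun _ he => (mem_edges.1 he).ne

theorem near_graph (u v : OVVertex n d q) (w : ℕ) (h : I.Edge q (u, v, w)) :
    (I.graph q).Near (number n d q u) (number n d q v) w :=
  (I.isEdgeList_graph q).near (List.mem_map.2 ⟨_, mem_edges.2 h, rfl⟩)

variable {I q} in
theorem weight_eq_one_or_two {e : Fin (count n d q) × Fin (count n d q) × ℕ}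
    (he : e ∈ I.edgeList q) : e.2.2 = 1 ∨ e.2.2 = 2 := by
  obtain ⟨x, hx, rfl⟩ := List.mem_map.1 he
  exact (mem_edges.1 hx).one_or_two

theorem weightsOneOrTwo_graph : (I.graph q).WeightsOneOrTwo :=
  (I.isEdgeList_graph q).weightsOneOrTwo fun _ => weight_eq_one_or_two

theorem dist_graph_le_ten (u v : Fin (count n d q)) : (I.graph q).dist u v ≤ 10 := by
  obtain ⟨u, rfl⟩ := (number n d q).surjective u
  obtain ⟨v, rfl⟩ := (number n d q).surjective v
  exact ((near_center (I.near_graph q) u).trans (near_center (I.near_graph q) v).symm).dist_le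

variable {I} in
theorem dist_graph_le_six (hI : ¬I.HasSolution) (u v : Fin (count n d q)) :
    (I.graph q).dist u v ≤ 6 := by
  obtain ⟨u, rfl⟩ := (number n d q).surjective u
  obtain ⟨v, rfl⟩ := (number n d q).surjective v
  exact (near_of_not_hasSolution (I.near_graph q) hI u v).dist_le

variable {I} in
theorem exists_ten_le_dist_graph (hI : I.HasSolution) :
    ∃ u v : Fin (count n d q), 10 ≤ (I.graph q).dist u v := by
  obtain ⟨a, b, c, hs⟩ := hasSolution_iff.1 hI
  let φ (k : Fin (count n d q)) : ℕ := I.potential a b c ((number n d q).symm k)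
  have hφ (e) (he : e ∈ I.edgeList q) : φ e.1 ≤ φ e.2.1 + e.2.2 ∧ φ e.2.1 ≤ φ e.1 + e.2.2 := by
    obtain ⟨x, hx, rfl⟩ := List.mem_map.1 he
    simpa only [φ, Equiv.symm_apply_apply] using (mem_edges.1 hx).potential hs
  refine ⟨number n d q (pair (0, a) b), number n d q (pair (1, c) b), ?_⟩
  simpa [φ, potential] using (I.isEdgeList_graph q).le_dist_of_potential hφ
    (u := number n d q (pair (0, a) b)) (v := number n d q (pair (1, c) b)) (by simp [φ, potential])

theorem length_edgeList_le : (I.edgeList q).length ≤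
    q + 4 * n + 4 * (n * n) + 2 * (n * (d * d)) + 3 * (n * n * (d * d)) := by
  have anchor_anchor := List.length_filter_le
    (fun (g, a) => a < g.2 : (Fin 2 × Fin n) × Fin n → Bool) (outerVectors n ×ˢ List.finRange n)
  have pair_coords := List.length_filter_le
    (fun (g, b, x, y) => I.PairAdj g b x y : (Fin 2 × Fin n) × Fin n × Fin d × Fin d → Bool)
    (outerVectors n ×ˢ (List.finRange n ×ˢ coordPairs d))
  have coords_coords := List.length_filter_le
    (fun (a, c, x, y) => I.CoordsAdj a c x y : Fin n × Fin n × Fin d × Fin d → Bool)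
    (List.finRange n ×ˢ (List.finRange n ×ˢ coordPairs d))
  simp only [edgeList, numberEdges, edges, outerVectors, coordPairs, List.length_map,
    List.length_append, List.length_product, List.length_finRange, ge_iff_le]
    at anchor_anchor pair_coords coords_coords ⊢
  linarith

theorem length_edgeList_le_count :
    (I.edgeList q).length ≤ 3 * (n * n * (d * d)) + 2 * count n d q := by
  refine (I.length_edgeList_le q).trans ?_
  have h : count n d q = 1 + q + 4 * n + 2 * (n * n) + 2 * (n * (d * d)) := by ring
  omega

end OVInstance

/-! ### Printing the graph of a `3`-OV instance -/

theorem mul_add_lt {k m i r : ℕ} (hi : i < k) (hr : r < m) : i * m + r < k * m :=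
  calc i * m + r < (i + 1) * m := by rw [add_mul, one_mul]; omega
    _ ≤ k * m := Nat.mul_le_mul_right m hi

theorem length_flatMap_finRange {β : Type*} {k c : ℕ} {f : Fin k → List β}
    (h : ∀ i, (f i).length = c) : ((List.finRange k).flatMap f).length = k * c := by
  simp [List.length_flatMap, h]

theorem getD_flatMap_finRange {k c r : ℕ} {f : Fin k → List ℕ} (h : ∀ i, (f i).length = c)
    (i : Fin k) (hr : r < c) :
    ((List.finRange k).flatMap f).getD (i * c + r) 0 = (f i).getD r 0 := by
  induction k with
  | zero => exact i.elim0
  | succ k ih =>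
    rw [List.finRange_succ, List.flatMap_cons, List.flatMap_map]
    refine Fin.cases ?_ (fun i => ?_) i
    · rw [List.getD_append _ _ _ _ (by simp [h, hr])]
      simp
    · rw [List.getD_append_right _ _ _ _ (by rw [h, Fin.val_succ, add_mul]; omega), h,
        ← ih (f := fun i => f i.succ) (fun i => h _) i]
      congr 1
      rw [Fin.val_succ, add_mul]
      omega

theorem flatMap_range {β : Type*} (k : ℕ) (f : ℕ → List β) :
    (List.range k).flatMap f = (List.finRange k).flatMap fun i : Fin k => f i.val := by
  rw [← List.map_coe_finRange_eq_range, List.flatMap_map]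

theorem flatMap_filter {α β : Type*} (p : α → Bool) (l : List α) (f : α → List β) :
    (l.filter p).flatMap f = l.flatMap fun a => if p a then f a else [] := by
  induction l with
  | nil => rfl
  | cons a l ih => by_cases h : p a <;> simp [h, ih]

theorem flatMap_product {α β γ : Type*} (l : List α) (l' : List β) (f : α × β → List γ) :
    (l ×ˢ l').flatMap f = l.flatMap fun a => l'.flatMap fun b => f (a, b) := by
  simp [SProd.sprod, List.product, List.flatMap_map, List.flatMap_assoc]

namespace OVInstance
open WordRAM OVVertex
variable {k n d : ℕ} (I : OVInstance k n d)

theorem length_encode : I.encode.length = 2 + k * (n * d) := by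
  have hfamily (j : Fin k) : ((List.finRange n).flatMap fun i =>
      (List.finRange d).map fun x => (I j i x).toNat).length = n * d :=
    length_flatMap_finRange fun _ => by simp
  rw [encode, List.length_cons, List.length_cons, length_flatMap_finRange hfamily]
  omega

theorem getD_encode (j : Fin k) (i : Fin n) (x : Fin d) :
    I.encode.getD (2 + ((j * n + i) * d + x)) 0 = (I j i x).toNat := by
  have h := getD_flatMap_finRange (f := fun j => (List.finRange n).flatMap fun i =>
    (List.finRange d).map fun x => (I j i x).toNat) (c := n * d) (r := i * d + x)
    (fun _ => length_flatMap_finRange fun _ => by simp) j (mul_add_lt i.2 x.2)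
  rw [encode, add_comm, List.getD_cons_succ, List.getD_cons_succ, add_mul, mul_assoc, add_assoc, h,
    getD_flatMap_finRange (fun _ => by simp) i x.2]
  simp

theorem le_of_mem_encode {x : ℕ} (hx : x ∈ I.encode) :
    x ≤ n + d + 1 := by
  simp only [encode, List.mem_cons, List.mem_flatMap, List.mem_map] at hx
  obtain rfl | rfl | ⟨j, -, i, -, y, -, rfl⟩ := hx
  · omega
  · omega
  · exact (Bool.toNat_le _).trans (by omega)

end OVInstance

/-- The words of `encodeGraph N L` without the number of the edges. -/
def edgeWords (N : ℕ) (L : List (Fin N × Fin N × ℕ)) : List ℕ :=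
  N :: L.flatMap fun e => [(e.1 : ℕ), (e.2.1 : ℕ), e.2.2]

theorem length_edgeWords {N : ℕ} (L : List (Fin N × Fin N × ℕ)) :
    (edgeWords N L).length = 1 + 3 * L.length := by
  simp [edgeWords, List.length_flatMap]
  ring

theorem length_encodeGraph {N : ℕ} (L : List (Fin N × Fin N × ℕ)) :
    (encodeGraph N L).length = 2 + 3 * L.length := by
  simp [encodeGraph, List.length_flatMap]
  ring

namespace WordRAM.OVGraph
open OVInstance OVVertex Gen

/-- `n`, in the memory of an encoded instance. -/
def vectors : Expr := .load 0

/-- `d`, in the memory of an encoded instance. -/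
def dim : Expr := .load 1

/-- The coordinate `x` of the vector `i` of the family `j` of an encoded instance. -/
def bit (j i x : Expr) : Expr := .load (2 + ((j * vectors + i) * dim + x))

/-- The number of the leaves, with a fixed factor `k`.  There are none for `k = 0`, and for `k = 1`
there are so many that the graph is sparse. -/
abbrev numLeaves (k n d : ℕ) : ℕ := k * (n * n * (d * d))

/-- The number of the leaves, for the factor `k`. -/
def leaves (k : ℕ) : Expr := .const k * (vectors * vectors * (dim * dim))

/-- The number of the vertex `anchor (σ, a)`. -/
def anchor (k : ℕ) (σ a : Expr) : Expr := 1 + leaves k + (a + vectors * σ)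

/-- The number of the vertex `hub (σ, a)`. -/
def hub (k : ℕ) (σ a : Expr) : Expr := 1 + leaves k + (2 * vectors + (a + vectors * σ))

/-- The number of the vertex `pair (σ, a) b`. -/
def pair (k : ℕ) (σ a b : Expr) : Expr :=
  1 + leaves k + (2 * vectors + 2 * vectors + (b + vectors * (a + vectors * σ)))

/-- The number of the vertex `coords (σ, a) x y`. -/
def coords (k : ℕ) (σ a x y : Expr) : Expr :=
  1 + leaves k + (2 * vectors + 2 * vectors +
    (2 * vectors * vectors + (y + dim * (x + dim * (a + vectors * σ)))))

/-- The number of the vertices. -/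
def count (k : ℕ) : Expr :=
  1 + leaves k + (2 * vectors + 2 * vectors + (2 * vectors * vectors + 2 * vectors * dim * dim))

/-- Print an edge with the ends `u`, `v` and the weight `w`. -/
def edge (u v w : Expr) : Gen := emit u ++ (emit v ++ emit w)

/-- Loop over the vectors `(σ, a)` of the two outer families. -/
def forOuter (body : Expr → Expr → Gen) : Gen :=
  forLoop 2 fun σ => forLoop vectors fun a => body σ a

/-- Loop over the pairs of coordinates. -/
def forCoords (body : Expr → Expr → Gen) : Gen :=
  forLoop dim fun x => forLoop dim fun y => body x y

/-- Print the number of the vertices and the edges of the graph of an instance. -/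
def gen (k : ℕ) : Gen :=
  emit (count k) ++
  ((forLoop (leaves k) fun i => edge 0 (1 + i) 1) ++
  ((forOuter fun σ a => edge (anchor k σ a) (hub k σ a) 1) ++
  ((forOuter fun σ a => edge 0 (hub k σ a) 2) ++
  ((forOuter fun σ a => forLoop vectors fun a' =>
    ite (.op .lt a' a) (edge (anchor k σ a) (anchor k σ a') 2)) ++
  ((forOuter fun σ a => forLoop vectors fun b => edge (anchor k σ a) (pair k σ a b) 2) ++
  ((forOuter fun σ a => forCoords fun x y => edge (hub k σ a) (coords k σ a x y) 1) ++
  ((forOuter fun σ a => forLoop vectors fun b => forCoords fun x y =>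
    ite (bit (2 * σ) a x * (bit (2 * σ) a y * bit 1 b x))
      (edge (pair k σ a b) (coords k σ a x y) 2)) ++
  forLoop vectors fun a => forLoop vectors fun c => forCoords fun x y =>
    ite (bit 0 a x * (bit 0 a y * (bit 2 c x * bit 2 c y)))
      (edge (coords k 0 a x y) (coords k 1 c y x) 2))))))))

section Out
variable {n d : ℕ} (I : OVInstance 3 n d)

theorem bits_eq_zero_iff_not_pairAdj (σ : Fin 2) (a b : Fin n) (x y : Fin d) :
    (initState I.encode).mem (2 + ((2 * σ * n + a) * d + x)) *
      ((initState I.encode).mem (2 + ((2 * σ * n + a) * d + y)) *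
        (initState I.encode).mem (2 + ((1 * n + b) * d + x))) = 0 ↔
      ¬I.PairAdj (σ, a) b x y := by
  have h (x : Fin d) : (initState I.encode).mem (2 + ((2 * σ * n + a) * d + x)) =
      (I (sideFamily σ) a x).toNat := I.getD_encode (sideFamily σ) a x
  have h' : (initState I.encode).mem (2 + ((1 * n + b) * d + x)) = (I 1 b x).toNat :=
    I.getD_encode 1 b x
  rw [h, h, h']
  simp [PairAdj, -not_and, not_and_or]

theorem bits_eq_zero_iff_not_coordsAdj (a c : Fin n) (x y : Fin d) :
    (initState I.encode).mem (2 + ((0 * n + a) * d + x)) *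
      ((initState I.encode).mem (2 + ((0 * n + a) * d + y)) *
        ((initState I.encode).mem (2 + ((2 * n + c) * d + x)) *
          (initState I.encode).mem (2 + ((2 * n + c) * d + y)))) = 0 ↔
      ¬I.CoordsAdj a c x y := by
  have h (x : Fin d) : (initState I.encode).mem (2 + ((0 * n + a) * d + x)) = (I 0 a x).toNat :=
    I.getD_encode 0 a x
  have h' (x : Fin d) : (initState I.encode).mem (2 + ((2 * n + c) * d + x)) = (I 2 c x).toNat :=
    I.getD_encode 2 c x
  rw [h, h, h', h']
  simp [CoordsAdj, -not_and, not_and_or]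

theorem out_gen (k B : ℕ) : (gen k).out (initState I.encode).mem [B] =
    edgeWords (OVVertex.count n d (numLeaves k n d)) (I.edgeList (numLeaves k n d)) := by
  have hn : (initState I.encode).mem 0 = n := rfl
  have hd : (initState I.encode).mem 1 = d := rfl
  have ite_lt (a b : ℕ) : (if a < b then 1 else 0) = 0 ↔ ¬a < b := by simp
  simp only [gen, edge, forOuter, forCoords, leaves, count, vectors, dim, anchor, hub, pair, coords,
    bit, out_append, out_forLoop, out_emit, out_ite, Expr.eval_add, Expr.eval_mul, Expr.eval_load,
    Expr.eval_const, Expr.eval_ofNat, Expr.eval_op, Op.eval, Expr.eval_var, List.length_cons,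
    List.length_nil, List.cons_append, List.nil_append, List.getD_cons_succ, List.getD_cons_zero,
    Nat.reduceAdd, zero_add, hn, hd, flatMap_range, ite_lt, bits_eq_zero_iff_not_pairAdj,
    bits_eq_zero_iff_not_coordsAdj, ite_not]
  simp only [edgeWords, edgeList, numberEdges, edges, outerVectors, OVInstance.coordPairs,
    List.flatMap_append, List.map_append, List.flatMap_map, flatMap_filter, flatMap_product,
    val_number_center, val_number_leaf, val_number_anchor, val_number_hub, val_number_pair,
    val_number_coords, decide_eq_true_eq, Fin.lt_def, Fin.val_zero, Fin.val_one]

theorem safe_gen {X B k : ℕ} (hB : 2 + 3 * (n * d) ≤ B) (hX : 2 < X) (hn : n < X) (hd : d < X)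
    (hk : numLeaves k n d < X) :
    (gen k).Safe X (Set.Iio B) (initState I.encode).mem [B] := by
  have bit_lt {j i x : ℕ} (hj : j < 3) (hi : i < n) (hx : x < d) :
      2 + ((j * n + i) * d + x) < B := by
    have := mul_add_lt (mul_add_lt hj hi) hx
    rw [mul_assoc] at this
    omega
  have h0 : 0 < B := by omega
  have h1 : 1 < B := by omega
  have pair_bits (σ) (hσ : σ ≤ 1) (a) (ha : a < n) (b) (hb : b < n) (x) (hx : x < d) (y)
      (hy : y < d) : 2 + ((2 * σ * n + a) * d + x) < B ∧ 2 + ((2 * σ * n + a) * d + y) < B ∧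
        2 + ((1 * n + b) * d + x) < B :=
    ⟨bit_lt (by omega) ha hx, bit_lt (by omega) ha hy, bit_lt (by omega) hb hx⟩
  have coords_bits (a) (ha : a < n) (c) (hc : c < n) (x) (hx : x < d) (y) (hy : y < d) :
      2 + ((0 * n + a) * d + x) < B ∧ 2 + ((0 * n + a) * d + y) < B ∧
        2 + ((2 * n + c) * d + x) < B ∧ 2 + ((2 * n + c) * d + y) < B :=
    ⟨bit_lt (by omega) ha hx, bit_lt (by omega) ha hy, bit_lt (by omega) hc hx,
      bit_lt (by omega) hc hy⟩
  have hn₀ : (initState I.encode).mem 0 = n := rfl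
  have hd₀ : (initState I.encode).mem 1 = d := rfl
  simpa [gen, edge, forOuter, forCoords, leaves, count, vectors, dim, anchor, hub, pair, coords,
    bit, hn₀, hd₀, hX, hn, hd, hk, h0, h1] using
    (And.intro pair_bits coords_bits :)

end Out

theorem time_gen_le (M : ℕ → ℕ) {k : ℕ} (B : ℕ) (hk : k ≤ 1) :
    (gen k).time M [B] ≤ 520 * ((M 0 + 1) ^ 2 * (M 1 + 1) ^ 2) := by
  have hkq : numLeaves k (M 0) (M 1) ≤ M 0 * M 0 * (M 1 * M 1) := by
    simpa using Nat.mul_le_mul_right _ hk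
  calc (gen k).time M [B]
    _ = 23 * numLeaves k (M 0) (M 1) + (240 + 347 * M 0 + 26 * (M 0 * M 1) +
          192 * (M 0 * M 1 ^ 2) + 331 * M 0 ^ 2 + 39 * (M 0 ^ 2 * M 1) +
          492 * (M 0 ^ 2 * M 1 ^ 2)) := by
      simp [gen, edge, forOuter, forCoords, leaves, count, vectors, dim, anchor, hub, pair, coords,
        bit]
      ring
    _ ≤ 520 * ((M 0 + 1) ^ 2 * (M 1 + 1) ^ 2) := by nlinarith

end WordRAM.OVGraph

namespace WordRAM.Gen

/-- Print the words from the address `B + k` to the address `E - 1`, where `B` and `E` are the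
variables `0` and `1`. -/
def copy (k : ℕ) : Gen :=
  forLoop (.var 1 - .var 0 - .const k) fun i => emit (.load (.var 0 + .const k + i))

theorem out_copy (l : List ℕ) (k B : ℕ) :
    (copy k).out (fun a => (initState l).mem (a - B)) [B, B + l.length] = l.drop k := by
  have hmap : ((List.range (l.length - k)).map fun i => (initState l).mem (k + i)) = l.drop k := by
    refine List.ext_getElem (by simp) fun i hi _ => ?_
    rw [List.length_map, List.length_range] at hi
    simp [initState, (by omega : k + i < l.length)]
  simpa [copy, add_assoc, ← List.map_eq_flatMap] using hmap

theorem safe_copy {X k B E : ℕ} {M : ℕ → ℕ} (hE : E < X) :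
    (copy k).Safe X (Set.Ico B E) M [B, E] := by
  have hcount : E - B - k < X := by omega
  have hmem (i) (hi : i < E - B - k) : B ≤ B + k + i ∧ B + k + i < E := by omega
  simpa [copy, hcount] using hmem

theorem time_copy (k B E : ℕ) (M : ℕ → ℕ) :
    (copy k).time M [B, E] = 18 * (E - B - k) + 7 := by
  simp [copy]
  ring

end WordRAM.Gen

namespace WordRAM.OVGraph
open OVInstance OVVertex Gen
variable {n d k : ℕ} (I : OVInstance 3 n d)

/-- Print the encoding of a graph, given the number of the vertices and the edges. -/
def insertEdgeCount : Gen := emit (.load (.var 0)) ++ (emit ((.var 1 - .var 0 - 1) / 3) ++ copy 1)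

/-- An upper bound for the size of the graph of an instance, up to a constant factor. -/
def size (n d : ℕ) : ℕ := (n + 1) ^ 2 * (d + 1) ^ 2

/-- More than the lengths of all lists that are in memory during the reduction. -/
def buffer : Expr := 14 * ((vectors + 1) * (vectors + 1) * ((dim + 1) * (dim + 1)))

/-- The reduction from `3`-OV to the diameter. -/
def prog (k : ℕ) : Prog := transform buffer (gen k) insertEdgeCount

section
variable {N : ℕ} (L : List (Fin N × Fin N × ℕ)) (B E : ℕ) (M : ℕ → ℕ)

theorem out_insertEdgeCount :
    insertEdgeCount.out (fun a => (initState (edgeWords N L)).mem (a - B))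
      [B, B + (edgeWords N L).length] = encodeGraph N L := by
  have hlen : ((edgeWords N L).length - 1) / 3 = L.length := by
    rw [length_edgeWords]
    omega
  have hhead : (initState (edgeWords N L)).mem 0 = N := rfl
  have htail : (edgeWords N L).drop 1 = L.flatMap fun e => [(e.1 : ℕ), (e.2.1 : ℕ), e.2.2] := rfl
  rw [insertEdgeCount, out_append, out_append, out_copy, htail]
  simp [hlen, hhead, encodeGraph]

variable {B E} in
theorem safe_insertEdgeCount {X : ℕ} (hBE : B < E) (hE : E < X) :
    insertEdgeCount.Safe X (Set.Ico B E) M [B, E] := by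
  simpa [insertEdgeCount, safe_copy hE] using hBE

theorem time_insertEdgeCount_le : insertEdgeCount.time M [B, E] ≤ 18 * (E - B) + 30 := by
  simp only [insertEdgeCount, time_append, time_emit, time_copy, Expr.cost_load, Expr.cost_div,
    Expr.cost_sub, Expr.cost_var, Expr.cost_ofNat]
  omega

end

theorem numLeaves_le (hk : k ≤ 1) : numLeaves k n d ≤ n * n * (d * d) := by
  simpa using Nat.mul_le_mul_right _ hk

theorem count_le_size (hk : k ≤ 1) : OVVertex.count n d (numLeaves k n d) ≤ 2 * size n d := by
  have := numLeaves_le (n := n) (d := d) hk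
  simp only [OVVertex.count, size]
  nlinarith

theorem length_edgeList_le_size (hk : k ≤ 1) :
    (I.edgeList (numLeaves k n d)).length ≤ 4 * size n d := by
  have := numLeaves_le (n := n) (d := d) hk
  have := I.length_edgeList_le (numLeaves k n d)
  simp only [size]
  nlinarith

theorem size_pos (n d : ℕ) : 0 < size n d := by simp [size]

theorem le_size (n d : ℕ) : n + d + n * d + 1 ≤ size n d := by
  rw [size, ← mul_pow]
  nlinarith [Nat.le_self_pow two_ne_zero ((n + 1) * (d + 1))]

theorem length_encode_le_size : I.encode.length ≤ 3 * size n d := by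
  have := le_size n d
  rw [length_encode]
  omega

theorem eval_buffer : buffer.eval (initState I.encode).mem [] = 14 * size n d := by
  have hn : (initState I.encode).mem 0 = n := rfl
  have hd : (initState I.encode).mem 1 = d := rfl
  simp [buffer, vectors, dim, hn, hd, size, sq]

theorem size_le (n d : ℕ) : 28 * size n d + 1 ≤ (n + d + 2) ^ 10 :=
  calc 28 * size n d + 1 ≤ 2 ^ 6 * size n d := by
        have := size_pos n d
        omega
    _ ≤ (n + d + 2) ^ 6 * ((n + d + 2) ^ 2 * (n + d + 2) ^ 2) := by
      rw [size]
      gcongr <;> omega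
    _ = (n + d + 2) ^ 10 := by ring

theorem lt_of_mem_encode {x : ℕ} (hx : x ∈ I.encode) : x < 28 * size n d + 1 := by
  have := I.le_of_mem_encode hx
  have := le_size n d
  omega

theorem lt_of_mem_edgeWords (hk : k ≤ 1) {x : ℕ}
    (hx : x ∈ edgeWords _ (I.edgeList (numLeaves k n d))) : x < 28 * size n d + 1 := by
  have hcount := count_le_size (n := n) (d := d) hk
  have hsize := size_pos n d
  simp only [edgeWords, List.mem_cons, List.mem_flatMap, List.not_mem_nil, or_false] at hx
  obtain rfl | ⟨e, he, rfl | rfl | rfl⟩ := hx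
  · omega
  · omega
  · omega
  · have := weight_eq_one_or_two he
    omega

theorem exists_runs_prog (hk : k ≤ 1) : ∃ c : ℕ, ∀ (n d : ℕ) (I : OVInstance 3 n d) (W : ℕ),
    (n + d + 2) ^ c ≤ W → ∃ t ≤ c * size n d, Runs W (prog k) (initState I.encode) t
      (initState (encodeGraph _ (I.edgeList (numLeaves k n d)))) := by
  set T := transformConst buffer (gen k) insertEdgeCount
  refine ⟨15 * T + 1000, fun n d I W hW => ?_⟩
  have hlen := length_edgeList_le_size I hk
  have hleaves := numLeaves_le (n := n) (d := d) hk
  have hinput := length_encode_le_size I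
  rw [length_encode] at hinput
  have hpos := size_pos n d
  have hX : (28 * size n d + 1) ^ T ≤ W :=
    calc (28 * size n d + 1) ^ T ≤ ((n + d + 2) ^ 10) ^ T := Nat.pow_le_pow_left (size_le n d) T
      _ = (n + d + 2) ^ (10 * T) := (pow_mul _ _ _).symm
      _ ≤ (n + d + 2) ^ (15 * T + 1000) := Nat.pow_le_pow_right (by omega) (by omega)
      _ ≤ W := hW
  have hwords := length_edgeWords (I.edgeList (numLeaves k n d))
  have hgraph := length_encodeGraph (I.edgeList (numLeaves k n d))
  obtain ⟨t, ht, run⟩ := runs_transform (X := 28 * size n d + 1) (B := 14 * size n d)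
    (output := encodeGraph _ (I.edgeList (numLeaves k n d))) (by omega) hX
    (fun _ => lt_of_mem_encode I) (fun _ => lt_of_mem_edgeWords I hk) (by omega)
    (by rw [length_encode]; omega) (by omega) (by omega) (eval_buffer I)
    (by simp [buffer, vectors, dim]) (out_gen I k _)
    (safe_gen I (by omega) (by omega) (lt_of_mem_encode I (by simp [encode]))
      (lt_of_mem_encode I (by simp [encode])) (by simp only [size]; nlinarith))
    (out_insertEdgeCount _ _) (safe_insertEdgeCount _ (by omega) (by omega))
  refine ⟨t, ht.trans ?_, run⟩
  have time_gen : (gen k).time (initState I.encode).mem [14 * size n d] ≤ 520 * size n d :=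
    time_gen_le (initState I.encode).mem (14 * size n d) hk
  have time_insert := time_insertEdgeCount_le (14 * size n d)
    (14 * size n d + (edgeWords _ (I.edgeList (numLeaves k n d))).length)
    (fun a => (initState (edgeWords _ (I.edgeList (numLeaves k n d)))).mem (a - 14 * size n d))
  rw [Nat.add_sub_cancel_left] at time_insert
  have hT : T * (14 * size n d + 1) ≤ 15 * T * size n d := by nlinarith
  change _ + T * _ ≤ _
  rw [add_mul]
  omega

end WordRAM.OVGraph

/-! ### From satisfiability to orthogonal vectors -/

namespace CNF
variable {N : ℕ} (φ : CNF N)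

/-- The number of variables in each of three blocks. -/
abbrev blockVars (N : ℕ) : ℕ := (N + 2) / 3

theorem div_blockVars_lt (v : Fin N) : (v : ℕ) / blockVars N < 3 := by
  have := v.2
  have hk : blockVars N = (N + 2) / 3 := rfl
  rw [Nat.div_lt_iff_lt_mul (by omega)]
  omega

theorem blockVars_le (N : ℕ) : blockVars N ≤ N := by
  rw [blockVars]
  omega

theorem le_three_mul_blockVars (N : ℕ) : N ≤ 3 * blockVars N := by
  rw [blockVars]
  omega

/-- The partial assignment with the number `i` to the block `j` satisfies the literal: the bits
of `i` are the values of the variables of the block. -/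
def LitSat (j i : ℕ) (l : Fin N × Bool) : Prop :=
  (l.1 : ℕ) / blockVars N = j ∧ i.testBit (l.1 % blockVars N) = l.2

instance (j i : ℕ) (l : Fin N × Bool) : Decidable (LitSat j i l) :=
  inferInstanceAs (Decidable (_ ∧ _))

/-- The vectors are the partial assignments to the three blocks, the coordinates are the clauses,
and a coordinate is zero if the clause is satisfied. -/
def toOV : OVInstance 3 (2 ^ blockVars N) φ.length :=
  fun j i x => !decide (∃ l ∈ φ[x], LitSat j i l)

theorem toOV_hasSolution_iff_exists : φ.toOV.HasSolution ↔
    ∃ f : Fin 3 → Fin (2 ^ blockVars N), ∀ cl ∈ φ, ∃ l ∈ cl, ∃ j : Fin 3, LitSat j (f j) l := by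
  simp only [OVInstance.HasSolution, Finset.sum_eq_zero_iff, Finset.mem_univ, true_imp_iff,
    Finset.prod_eq_zero_iff, true_and, toOV, Bool.toNat_eq_zero, Bool.not_eq_false',
    decide_eq_true_eq]
  refine exists_congr fun f => ⟨fun h cl hcl => ?_, fun h x => ?_⟩
  · obtain ⟨x, hx, rfl⟩ := List.mem_iff_getElem.1 hcl
    obtain ⟨j, l, hl, hsat⟩ := h ⟨x, hx⟩
    exact ⟨l, hl, j, hsat⟩
  · obtain ⟨l, hl, j, hsat⟩ := h φ[x] (List.getElem_mem x.2)
    exact ⟨j, l, hl, hsat⟩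

theorem toOV_hasSolution_iff : φ.toOV.HasSolution ↔ φ.Satisfiable := by
  rw [toOV_hasSolution_iff_exists]
  constructor
  · rintro ⟨f, hf⟩
    refine ⟨fun v => (f ⟨v / blockVars N, div_blockVars_lt v⟩ : ℕ).testBit (v % blockVars N),
      fun cl hcl => ?_⟩
    obtain ⟨l, hl, j, hblock, hbit⟩ := hf cl hcl
    have hj : (⟨l.1 / blockVars N, div_blockVars_lt l.1⟩ : Fin 3) = j := Fin.ext hblock
    exact ⟨l, hl, hbit ▸ congrArg (fun j => (f j : ℕ).testBit _) hj⟩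
  · rintro ⟨σ, hσ⟩
    let f : Fin 3 → Fin (2 ^ blockVars N) := fun j =>
      ⟨Nat.ofBits fun b : Fin (blockVars N) =>
        if h : j * blockVars N + b < N then σ ⟨_, h⟩ else false, Nat.ofBits_lt_two_pow _⟩
    refine ⟨f, fun cl hcl => ?_⟩
    obtain ⟨l, hl, hsat⟩ := hσ cl hcl
    refine ⟨l, hl, ⟨_, div_blockVars_lt l.1⟩, rfl, ?_⟩
    have hmod : (l.1 : ℕ) % blockVars N < blockVars N :=
      Nat.mod_lt _ (by have := l.1.2; simp only [blockVars]; omega)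
    simp [f, Nat.testBit_ofBits_lt _ _ hmod, Nat.div_add_mod', hsat]

/-- The words that encode a clause. -/
def clauseWords (cl : List (Fin N × Bool)) : List ℕ :=
  cl.length :: cl.map fun l => 2 * (l.1 : ℕ) + l.2.toNat

/-- The address of a clause. -/
def clauseAddr (x : ℕ) : ℕ := 2 + ((φ.take x).flatMap clauseWords).length

theorem encode_eq : φ.encode = N :: φ.length :: φ.flatMap clauseWords := rfl

theorem getD_encode (x : Fin φ.length) {r : ℕ} (hr : r ≤ (φ[x]).length) :
    φ.encode.getD (φ.clauseAddr x + r) 0 = (clauseWords φ[x]).getD r 0 := by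
  have hsplit : φ.flatMap clauseWords = (φ.take x).flatMap clauseWords ++
      (clauseWords φ[x] ++ (φ.drop (x + 1)).flatMap clauseWords) := by
    rw [← List.flatMap_cons, ← List.flatMap_append, Fin.getElem_fin,
      ← List.drop_eq_getElem_cons x.2, List.take_append_drop]
  have hlen : r < (clauseWords φ[x]).length := by simpa [clauseWords] using hr
  rw [encode_eq, hsplit, clauseAddr, show ∀ a, 2 + a + r = a + r + 1 + 1 by intros; omega,
    List.getD_cons_succ, List.getD_cons_succ, List.getD_append_right _ _ _ _ (by omega),
    Nat.add_sub_cancel_left, List.getD_append _ _ _ _ hlen]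

theorem clauseAddr_succ (x : Fin φ.length) :
    φ.clauseAddr (x + 1) = φ.clauseAddr x + ((φ[x]).length + 1) := by
  rw [clauseAddr, clauseAddr, List.take_add_one, List.getElem?_eq_getElem x.2]
  simp [clauseWords]
  omega

variable {φ} {K : ℕ}

theorem length_flatMap_clauseWords_le (hK : ∀ cl ∈ φ, cl.length ≤ K) :
    (φ.flatMap clauseWords).length ≤ (K + 1) * φ.length := by
  rw [List.length_flatMap, mul_comm, ← smul_eq_mul, ← List.length_map (f := fun cl => _)]
  exact List.sum_le_card_nsmul _ _ (by simpa [clauseWords] using hK)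

theorem clauseAddr_le (hK : ∀ cl ∈ φ, cl.length ≤ K) (x : ℕ) :
    φ.clauseAddr x ≤ 2 + (K + 1) * φ.length :=
  Nat.add_le_add_left ((length_flatMap_clauseWords_le fun cl hcl =>
    hK cl (List.mem_of_mem_take hcl)).trans (Nat.mul_le_mul_left _ (by simp))) 2

theorem length_encode_le (hK : ∀ cl ∈ φ, cl.length ≤ K) :
    φ.encode.length ≤ 2 + (K + 1) * φ.length := by
  have := length_flatMap_clauseWords_le hK
  rw [encode_eq, List.length_cons, List.length_cons]
  omega

theorem le_of_mem_encode (hK : ∀ cl ∈ φ, cl.length ≤ K) {x : ℕ} (hx : x ∈ φ.encode) :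
    x ≤ 2 * N + φ.length + K := by
  simp only [encode_eq, clauseWords, List.mem_cons, List.mem_flatMap, List.mem_map] at hx
  obtain rfl | rfl | ⟨cl, hcl, rfl | ⟨l, -, rfl⟩⟩ := hx
  · omega
  · omega
  · have := hK cl hcl
    omega
  · have := l.1.2
    have := Bool.toNat_le l.2
    omega

end CNF

namespace WordRAM.SatOV
open CNF Gen

/-- Whether the literal `l` of the clause at the address `a` exists and is satisfied by the partial
assignment `i` to the block `j`, if the blocks have `k` variables. -/
def litSat (k j i a : Expr) (l : ℕ) : Expr :=
  .op .lt (.const l) (.load a) * (.op .eq (.load (a + .const (l + 1)) / 2 / k) j *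
    .op .eq (.op .shr i (.load (a + .const (l + 1)) / 2 % k) % 2) (.load (a + .const (l + 1)) % 2))

/-- Whether the partial assignment `i` to the block `j` satisfies none of the first literals of the
clause at the address `a`. -/
def noneSat (k j i a : Expr) : ℕ → Expr
  | 0 => 1
  | K + 1 => noneSat k j i a K * (1 - litSat k j i a K)

/-- The number of variables in each of the three blocks. -/
def blockSize : Expr := (.load 0 + 2) / 3

/-- Print the `3`-OV instance of a formula with at most `K` literals per clause. -/
def gen (K : ℕ) : Gen :=
  bind blockSize fun k => bind (.op .shl 1 k) fun n =>
    emit n ++ (emit (.load 1) ++ forLoop 3 fun j => forLoop n fun i =>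
      loop (.load 1) 2 (fun a => .load a + 1) fun a => emit (noneSat k j i a K))

/-- More than the lengths of all lists that are in memory during the reduction. -/
def buffer (K : ℕ) : Expr := .const (2 * K + 6) * (.op .shl 1 blockSize * (.load 1 + 1))

/-- The size of the `3`-OV instance of a formula with `m` clauses, up to a constant factor. -/
def size (N m : ℕ) : ℕ := 2 ^ blockVars N * (m + 1)

/-- The reduction from satisfiability to `3`-OV. -/
def prog (K : ℕ) : Prog := transform (buffer K) (gen K) (copy 0)

section
variable {X K : ℕ} {R : Set ℕ} {M : ℕ → ℕ} {Γ : List ℕ} {k j i a : Expr}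

theorem safe_noneSat (hk : k.Safe X R M Γ) (hj : j.Safe X R M Γ) (hi : i.Safe X R M Γ)
    (ha : a.Safe X R M Γ) (hR : ∀ l ≤ K, a.eval M Γ + l ∈ R) :
    (noneSat k j i a K).Safe X R M Γ := by
  induction K with
  | zero => trivial
  | succ K ih =>
    have hlit : (litSat k j i a K).Safe X R M Γ := by
      have := hR 0 (by omega)
      have := hR (K + 1) le_rfl
      simp_all [litSat, Expr.Safe]
    exact Expr.safe_mul.2 ⟨ih fun l hl => hR l (by omega), Expr.safe_sub.2 ⟨trivial, hlit⟩⟩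

theorem eval_noneSat {p : ℕ → Prop} [DecidablePred p]
    (h : ∀ l < K, (litSat k j i a l).eval M Γ = if p l then 1 else 0) :
    (noneSat k j i a K).eval M Γ = if ∃ l < K, p l then 0 else 1 := by
  induction K with
  | zero => simp [noneSat]
  | succ K ih =>
    rw [noneSat, Expr.eval_mul, ih fun l hl => h l (by omega), Expr.eval_sub, h K (by omega)]
    simp only [Nat.lt_succ_iff_lt_or_eq, or_and_right, exists_or, exists_eq_left]
    by_cases hlt : ∃ l < K, p l
    · simp [hlt]
    · by_cases hK : p K <;> simp [hlt, hK]

end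

theorem eval_litSat {N : ℕ} {M : ℕ → ℕ} {Γ : List ℕ} {k j i a : Expr}
    {cl : List (Fin N × Bool)} (hk : k.eval M Γ = blockVars N)
    (ha : ∀ r ≤ cl.length, M (a.eval M Γ + r) = (clauseWords cl).getD r 0) (l : ℕ) :
    (litSat k j i a l).eval M Γ =
      if ∃ h : l < cl.length, LitSat (j.eval M Γ) (i.eval M Γ) cl[l] then 1 else 0 := by
  have hlen : M (a.eval M Γ) = cl.length := ha 0 (Nat.zero_le _)
  by_cases hl : l < cl.length
  · have hword : M (a.eval M Γ + (l + 1)) = 2 * (cl[l].1 : ℕ) + cl[l].2.toNat := by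
      rw [ha _ hl, clauseWords, List.getD_cons_succ, List.getD_eq_getElem _ _ (by simpa using hl),
        List.getElem_map]
    have hvar : M (a.eval M Γ + (l + 1)) / 2 = cl[l].1 := by
      have := Bool.toNat_le cl[l].2
      omega
    have hsign : M (a.eval M Γ + (l + 1)) % 2 = cl[l].2.toNat := by
      have := Bool.toNat_le cl[l].2
      omega
    have hbit (x y : ℕ) : x >>> y % 2 = cl[l].2.toNat ↔ x.testBit y = cl[l].2 := by
      rw [Nat.shiftRight_eq_div_pow, ← Nat.toNat_testBit]
      cases x.testBit y <;> cases cl[l].2 <;> simp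
    simp [litSat, LitSat, hk, hlen, hl, hvar, hsign, hbit, Op.eval, ← ite_and, and_comm]
  · have hlt : (Expr.op .lt (.const l) (.load a)).eval M Γ = 0 := by simp [Op.eval, hlen, hl]
    rw [litSat, Expr.eval_mul, hlt, zero_mul, if_neg fun h => hl h.1]

section
variable {N K : ℕ} {φ : CNF N} (hK : ∀ cl ∈ φ, cl.length ≤ K)

include hK in
theorem eval_noneSat_eq_toOV {Γ : List ℕ} {k j i a : Expr} (j' : Fin 3)
    (i' : Fin (2 ^ blockVars N)) (x : Fin φ.length)
    (hk : k.eval (initState φ.encode).mem Γ = blockVars N)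
    (hj : j.eval (initState φ.encode).mem Γ = j') (hi : i.eval (initState φ.encode).mem Γ = i')
    (ha : a.eval (initState φ.encode).mem Γ = φ.clauseAddr x) :
    (noneSat k j i a K).eval (initState φ.encode).mem Γ = (φ.toOV j' i' x).toNat := by
  have hlit (l : ℕ) := eval_litSat (j := j) (i := i) (cl := φ[x]) hk
    (fun r hr => by rw [ha]; exact φ.getD_encode x hr) l
  have hsat : (∃ l < K, ∃ h : l < φ[x].length, LitSat j' i' φ[x][l]) ↔
      ∃ l ∈ φ[x], LitSat j' i' l := by
    refine ⟨fun ⟨l, _, hl, h⟩ => ⟨_, List.getElem_mem hl, h⟩, fun ⟨l, hl, h⟩ => ?_⟩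
    obtain ⟨r, hr, rfl⟩ := List.mem_iff_getElem.1 hl
    exact ⟨r, hr.trans_le (hK _ (List.getElem_mem x.2)), hr, h⟩
  rw [eval_noneSat fun l _ => hlit l, hj, hi]
  simp only [hsat, toOV]
  by_cases h : ∃ l ∈ φ[x], LitSat j' i' l <;> simp only [h, decide_true, decide_false] <;> rfl

theorem loopVar_clauseAddr (Γ : List ℕ) {x : ℕ} (hx : x ≤ φ.length) :
    loopVar (initState φ.encode).mem Γ φ.length 2 (fun a => .load a + 1) x = φ.clauseAddr x := by
  induction x with
  | zero => rfl
  | succ x ih =>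
    rw [loopVar, ih (by omega)]
    refine (congrArg (φ.clauseAddr x + ·) ?_).trans (φ.clauseAddr_succ ⟨x, hx⟩).symm
    have hlen : (initState φ.encode).mem (φ.clauseAddr x) = φ[x].length :=
      φ.getD_encode ⟨x, hx⟩ (Nat.zero_le _)
    simpa using hlen

theorem loopVars_clauseAddr (Γ : List ℕ) {x : ℕ} (hx : x ≤ φ.length) :
    loopVars (initState φ.encode).mem Γ φ.length 2 (fun a => .load a + 1) x =
      Γ ++ [φ.length - x, φ.clauseAddr x] := by
  rw [loopVars, loopVar_clauseAddr Γ hx]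

include hK in
theorem out_gen (B : ℕ) : (gen K).out (initState φ.encode).mem [B] = φ.toOV.encode := by
  have hN : (initState φ.encode).mem 0 = N := rfl
  have hM : (initState φ.encode).mem 1 = φ.length := rfl
  have hbit (j : Fin 3) (i : Fin (2 ^ blockVars N)) (x : Fin φ.length) :
      (noneSat (.var 1) (.var 4) (.var 6) (.var 8) K).eval (initState φ.encode).mem
        [B, blockVars N, 2 ^ blockVars N, 3 - j, j, 2 ^ blockVars N - i, i, φ.length - x,
          φ.clauseAddr x] = (φ.toOV j i x).toNat :=
    eval_noneSat_eq_toOV hK j i x rfl rfl rfl rfl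
  rw [OVInstance.encode]
  simp only [List.map_eq_flatMap]
  simp [gen, blockSize, out, ← List.map_coe_finRange_eq_range, List.flatMap_map, hN, hM, Op.eval,
    Nat.one_shiftLeft, loopVars_clauseAddr, hbit, ← List.map_eq_flatMap]

include hK in
theorem safe_gen {X B : ℕ} (hB : 2 + (K + 1) * φ.length + K < B) (hX : 3 < X) (hBX : B < X)
    (hn : 2 ^ blockVars N < X) :
    (gen K).Safe X (Set.Iio B) (initState φ.encode).mem [B] := by
  have hN : (initState φ.encode).mem 0 = N := rfl
  have hM : (initState φ.encode).mem 1 = φ.length := rfl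
  have addr_add_lt (x : ℕ) {l : ℕ} (hl : l ≤ K) : φ.clauseAddr x + l < B := by
    have := clauseAddr_le hK x
    omega
  have hsize : blockVars N < X := Nat.lt_two_pow_self.trans hn
  have hlen : φ.length < X := by nlinarith
  have addr_lt_X {Γ : List ℕ} (x : ℕ) (hx : x ≤ φ.length) : loopVar (initState φ.encode).mem Γ
      φ.length 2 (fun a => .load a + 1) x < X :=
    loopVar_clauseAddr (φ := φ) Γ hx ▸ (addr_add_lt x (Nat.zero_le _)).trans hBX
  have addr_lt (x : ℕ) : φ.clauseAddr x < B := addr_add_lt x (Nat.zero_le _)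
  have h1 : 1 < B := by omega
  simp +contextual [gen, blockSize, hN, hM, Safe, Nat.one_shiftLeft, Op.eval, hX, hn, hsize, hlen,
    addr_lt_X, loopVars_clauseAddr, safe_noneSat, addr_add_lt, le_of_lt, addr_lt, h1,
    Nat.zero_lt_of_lt h1]

theorem time_gen_le (K B : ℕ) : (gen K).time (initState φ.encode).mem [B] ≤
    3 * ((noneSat (.var 1) (.var 4) (.var 6) (.var 8) K).cost + 27) * size N φ.length + 21 := by
  have hN : (initState φ.encode).mem 0 = N := rfl
  have hM : (initState φ.encode).mem 1 = φ.length := rfl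
  have hn : 0 < 2 ^ blockVars N := Nat.two_pow_pos _
  set T := (noneSat (.var 1) (.var 4) (.var 6) (.var 8) K).cost
  have htime : (gen K).time (initState φ.encode).mem [B] =
      3 * (2 ^ blockVars N * (φ.length * (T + 15) + 13) + 12) + 21 := by
    simp [gen, blockSize, hN, hM, time, Nat.one_shiftLeft, Op.eval, blockVars, T]
    ring
  rw [htime, size]
  nlinarith

theorem eval_buffer (K : ℕ) : (buffer K).eval (initState φ.encode).mem [] =
    (2 * K + 6) * size N φ.length := by
  have hN : (initState φ.encode).mem 0 = N := rfl
  have hM : (initState φ.encode).mem 1 = φ.length := rfl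
  simp [buffer, blockSize, hN, hM, Op.eval, Nat.one_shiftLeft, size]

theorem safe_buffer {X : ℕ} (hn : 2 ^ blockVars N < X) :
    (buffer K).Safe X Set.univ (initState φ.encode).mem [] := by
  have hN : (initState φ.encode).mem 0 = N := rfl
  simpa [buffer, blockSize, hN, Nat.one_shiftLeft] using hn

end

theorem two_mul_buffer_add_one_le (K N m : ℕ) :
    2 * ((2 * K + 6) * size N m) + 1 ≤ (2 ^ N * (m + 2)) ^ (K + 5) := by
  have hbase : 2 ≤ 2 ^ N * (m + 2) := by nlinarith [Nat.one_le_two_pow (n := N)]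
  have hsize : size N m ≤ 2 ^ N * (m + 2) :=
    Nat.mul_le_mul (Nat.pow_le_pow_right two_pos (blockVars_le N)) (by omega)
  have hK : 4 * K + 13 ≤ 2 ^ (K + 4) := by
    have := Nat.lt_two_pow_self (n := K)
    rw [pow_add]
    omega
  calc 2 * ((2 * K + 6) * size N m) + 1 ≤ (4 * K + 13) * (2 ^ N * (m + 2)) := by nlinarith
    _ ≤ (2 ^ N * (m + 2)) ^ (K + 4) * (2 ^ N * (m + 2)) := by
      gcongr
      exact hK.trans (Nat.pow_le_pow_left hbase _)
    _ = (2 ^ N * (m + 2)) ^ (K + 5) := (pow_succ _ _).symm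

theorem exists_runs_prog (K : ℕ) : ∃ c : ℕ, ∀ (N : ℕ) (φ : CNF N), (∀ cl ∈ φ, cl.length ≤ K) →
    ∀ W : ℕ, (2 ^ N * (φ.length + 2)) ^ c ≤ W → ∃ t ≤ c * size N φ.length,
      Runs W (prog K) (initState φ.encode) t (initState φ.toOV.encode) := by
  set T := transformConst (buffer K) (gen K) (copy 0)
  set T' := (noneSat (.var 1) (.var 4) (.var 6) (.var 8) K).cost
  refine ⟨(2 * K + 7) * T + 3 * T' + 200, fun N φ hK W hW => ?_⟩
  set S := size N φ.length
  have hn : 0 < 2 ^ blockVars N := Nat.two_pow_pos _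
  have hnS : 2 ^ blockVars N ≤ S := Nat.le_mul_of_pos_right _ (Nat.succ_pos _)
  have hmS : φ.length + 1 ≤ S := Nat.le_mul_of_pos_left _ hn
  have hnm : 2 ^ blockVars N * φ.length ≤ S := Nat.mul_le_mul_left _ (Nat.le_succ _)
  have hKm : K * (φ.length + 1) ≤ K * S := Nat.mul_le_mul_left K hmS
  have hB : (2 * K + 6) * S = 2 * (K * S) + 6 * S := by ring
  have hencode := length_encode_le hK
  rw [show 2 + (K + 1) * φ.length = 2 + K * φ.length + φ.length by ring] at hencode
  have hNn : N ≤ 3 * 2 ^ blockVars N :=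
    (le_three_mul_blockVars N).trans (Nat.mul_le_mul_left 3 Nat.lt_two_pow_self.le)
  rw [mul_add] at hKm
  have hX : (2 * ((2 * K + 6) * S) + 1) ^ T ≤ W :=
    calc (2 * ((2 * K + 6) * S) + 1) ^ T ≤ ((2 ^ N * (φ.length + 2)) ^ (K + 5)) ^ T :=
          Nat.pow_le_pow_left (two_mul_buffer_add_one_le K N φ.length) T
      _ = (2 ^ N * (φ.length + 2)) ^ ((K + 5) * T) := (pow_mul _ _ _).symm
      _ ≤ (2 ^ N * (φ.length + 2)) ^ ((2 * K + 7) * T + 3 * T' + 200) :=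
        Nat.pow_le_pow_right (Nat.mul_pos (Nat.two_pow_pos N) (Nat.succ_pos _)) (by nlinarith)
      _ ≤ W := hW
  have hOV := φ.toOV.length_encode
  obtain ⟨t, ht, run⟩ := runs_transform (B := (2 * K + 6) * S) (output := φ.toOV.encode)
    (by omega) hX (fun x hx => by have := le_of_mem_encode hK hx; omega)
    (fun x hx => by have := OVInstance.le_of_mem_encode _ hx; omega) (by omega)
    (by omega) (by omega) (by omega) (eval_buffer K) (safe_buffer (by omega)) (out_gen hK _)
    (safe_gen hK (by rw [add_mul]; omega) (by omega) (by omega) (by omega))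
    (out_copy _ _ _) (safe_copy (by omega))
  refine ⟨t, ht.trans ?_, run⟩
  have htime := time_gen_le (φ := φ) K ((2 * K + 6) * S)
  have hT : T * ((2 * K + 6) * S + 1) ≤ (2 * K + 7) * T * S := by nlinarith
  rw [time_copy, Nat.add_sub_cancel_left, hOV, Nat.sub_zero]
  change _ ≤ (3 * (T' + 27) * S + 21) at htime
  change _ + T * _ ≤ _
  nlinarith

end WordRAM.SatOV

theorem WordRAM.outputs_initState (l : List ℕ) : (initState l).Outputs l := fun _ h =>
  List.getD_eq_getElem l 0 h

namespace WordRAM.OVGraph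
open OVInstance

theorem count_numLeaves_zero_le {n : ℕ} (d : ℕ) (hn : 1 ≤ n) :
    OVVertex.count n d (numLeaves 0 n d) ≤ 9 * (n ^ 2 + n * d ^ 2) := by
  have : OVVertex.count n d (numLeaves 0 n d) = 1 + 4 * n + 2 * n ^ 2 + 2 * (n * d ^ 2) := by ring
  nlinarith

theorem length_edgeList_numLeaves_zero_le {n d : ℕ} (I : OVInstance 3 n d) (hd : 1 ≤ d) :
    (I.edgeList (numLeaves 0 n d)).length ≤ 13 * (n ^ 2 * d ^ 2) := by
  have hn : n ≤ n ^ 2 := Nat.le_self_pow two_ne_zero n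
  have hn' : n ^ 2 ≤ n ^ 2 * d ^ 2 := Nat.le_mul_of_pos_right _ (Nat.pow_pos hd)
  have hnd : n * d ^ 2 ≤ n ^ 2 * d ^ 2 := Nat.mul_le_mul_right _ hn
  calc (I.edgeList (numLeaves 0 n d)).length
      ≤ 0 * (n * n * (d * d)) + 4 * n + 4 * (n * n) + 2 * (n * (d * d)) + 3 * (n * n * (d * d)) :=
        I.length_edgeList_le _
    _ = 4 * n + 4 * n ^ 2 + 2 * (n * d ^ 2) + 3 * (n ^ 2 * d ^ 2) := by ring
    _ ≤ 13 * (n ^ 2 * d ^ 2) := by omega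

theorem exists_reduction : ∃ (P : Prog) (c : ℕ), ∀ (n d : ℕ), 1 ≤ n → 1 ≤ d →
    ∀ I : OVInstance 3 n d, ∃ (t : ℕ) (s : State) (N : ℕ) (G : WeightedGraph (Fin N))
      (L : List (Fin N × Fin N × ℕ)),
      HaltsOn ((n + d + 2) ^ c) P I.encode t s ∧
      t ≤ c * (n ^ 2 * d ^ 2) ∧
      IsEdgeList G L ∧
      s.Outputs (encodeGraph N L) ∧
      N ≤ c * (n ^ 2 + n * d ^ 2) ∧
      L.length ≤ c * (n ^ 2 * d ^ 2) ∧
      G.WeightsOneOrTwo ∧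
      (¬ I.HasSolution → ∀ u v : Fin N, G.dist u v ≤ 6) ∧
      (I.HasSolution → ∃ u v : Fin N, 10 ≤ G.dist u v) := by
  obtain ⟨c, hc⟩ := exists_runs_prog zero_le_one
  refine ⟨prog 0, 16 * c + 13, fun n d hn hd I => ?_⟩
  obtain ⟨t, ht, run⟩ := hc n d I ((n + d + 2) ^ (16 * c + 13))
    (Nat.pow_le_pow_right (by omega) (by omega))
  have hsize : size n d ≤ 16 * (n ^ 2 * d ^ 2) :=
    calc size n d ≤ (n + n) ^ 2 * (d + d) ^ 2 := by rw [size]; gcongr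
      _ = 16 * (n ^ 2 * d ^ 2) := by ring
  have hinput (x) (hx : x ∈ I.encode) : x < (n + d + 2) ^ (16 * c + 13) :=
    (Nat.lt_succ_of_le (I.le_of_mem_encode hx)).trans_le (Nat.le_self_pow (by omega) _)
  refine ⟨t, _, _, I.graph _, I.edgeList _, ⟨hinput, run⟩, ?_, I.isEdgeList_graph _,
    outputs_initState _, ?_, ?_, I.weightsOneOrTwo_graph _, dist_graph_le_six _,
    exists_ten_le_dist_graph _⟩
  · nlinarith
  · exact (count_numLeaves_zero_le d hn).trans (Nat.mul_le_mul_right _ (by omega))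
  · exact (length_edgeList_numLeaves_zero_le I hd).trans (Nat.mul_le_mul_right _ (by omega))

end WordRAM.OVGraph

/-! ### From approximations of the diameter to satisfiability -/

namespace OVInstance
variable {n d q : ℕ} (I : OVInstance 3 n d)

theorem exists_diameter_graph_eq (q : ℕ) : ∃ D : ℕ, (I.graph q).diameter = D := by
  have h : (I.graph q).diameter ≤ 10 := iSup₂_le (I.dist_graph_le_ten q)
  obtain ⟨D, hD⟩ := ENat.ne_top_iff_exists.1 (ne_top_of_le_ne_top (by simp) h)
  exact ⟨D, hD.symm⟩

variable {I}

theorem diameter_graph_le_six (hI : ¬I.HasSolution) : (I.graph q).diameter ≤ 6 :=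
  iSup₂_le (dist_graph_le_six q hI)

theorem ten_le_diameter_graph (hI : I.HasSolution) : 10 ≤ (I.graph q).diameter := by
  obtain ⟨u, v, h⟩ := exists_ten_le_dist_graph q hI
  exact h.trans (le_iSup₂ (f := fun u v => (I.graph q).dist u v) u v)

end OVInstance

theorem exists_natCast_div_btwn {x y : ℝ} (hxy : x < y) (hy : 0 < y) :
    ∃ a b : ℕ, 0 < b ∧ 0 < (a : ℝ) / b ∧ x < (a : ℝ) / b ∧ (a : ℝ) / b < y := by
  obtain ⟨r, hlt, hry⟩ := exists_rat_btwn (max_lt hxy hy)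
  obtain ⟨hxr, hr⟩ := max_lt_iff.1 hlt
  have hcast : (r.num.toNat : ℝ) / r.den = r := by
    have hnum : (r.num.toNat : ℤ) = r.num := Int.toNat_of_nonneg (Rat.num_pos.2 (mod_cast hr)).le
    rw [← Int.cast_natCast, hnum, ← Rat.cast_def]
  exact ⟨r.num.toNat, r.den, r.den_pos, by rwa [hcast], by rwa [hcast], by rwa [hcast]⟩

namespace WordRAM
variable {W V t : ℕ} {p : Prog} {l : List ℕ} {s : State}

theorem HaltsOn.mono (h : HaltsOn V p l t s) (hVW : V ≤ W) : HaltsOn W p l t s :=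
  ⟨fun x hx => (h.1 x hx).trans_le hVW, h.2.mono hVW⟩

theorem HaltsOn.reg_lt (h : HaltsOn V p l t s) (hV : 0 < V) (k : ℕ) : s.reg k < V :=
  (h.2.reg_lt_and_mem_lt ⟨fun _ => hV, initState_mem_lt hV h.1⟩).1 k

/-- Test if the fraction in the registers `0` and `1` is greater than `a / b`. -/
def exceeds (a b : ℕ) : Prog := .seq (.instr (.const 2 b)) (.seq (.instr (.op .mul 0 0 2))
  (.seq (.instr (.const 2 a)) (.seq (.instr (.op .mul 1 1 2)) (.instr (.op .lt 0 1 0)))))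

theorem exists_runs_exceeds {a b : ℕ} (hb : 0 < b) (h0 : s.reg 0 < V)
    (h1 : s.reg 1 < V) (hW : V * (a + b + 2) ≤ W) (hs : s.reg 1 ≠ 0) : ∃ s',
      Runs W (exceeds a b) s 5 s' ∧ (s'.reg 0 ≠ 0 ↔ (a : ℝ) / b < (s.reg 0 : ℝ) / s.reg 1) := by
  have haW : a < W := by nlinarith
  have hbW : b < W := by nlinarith
  have hW1 : 1 < W := by nlinarith
  have hnum : s.reg 0 * b < W := by nlinarith
  have hden : s.reg 1 * a < W := by nlinarith
  refine ⟨_, .seq (.instr _ _ hbW) (.seq (.instr _ _ ?_) (.seq (.instr _ _ haW)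
    (.seq (.instr _ _ ?_) (.instr _ _ ?_)))), ?_⟩
  · simpa [Instr.exec, Instr.value, Op.eval] using hnum
  · simpa [Instr.exec, Instr.value, Op.eval] using hden
  · simp only [Instr.value, Op.eval]
    split_ifs <;> omega
  · rw [div_lt_div_iff₀ (Nat.cast_pos.2 hb) (Nat.cast_pos.2 (Nat.pos_of_ne_zero hs))]
    norm_cast
    simp [Instr.exec, Instr.value, Op.eval, mul_comm a]

end WordRAM

open WordRAM in
theorem SparseDiameterApprox.exists_distinguishes {C₀ p q : ℕ} {lo hi τ : ℝ} (hlo : 0 < lo)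
    (hq : 0 < q) (hgap : p * hi < q * lo) (h : SparseDiameterApprox C₀ lo hi τ) :
    ∃ (P : Prog) (c : ℕ), ∀ (n D : ℕ) (G : WeightedGraph (Fin n)) (L : List (Fin n × Fin n × ℕ)),
      0 < n → IsEdgeList G L → L.length ≤ C₀ * n → G.WeightsOneOrTwo → G.diameter = D →
      ∃ (t : ℕ) (s : State), HaltsOn ((n + 2) ^ c) P (encodeGraph n L) t s ∧
        (t : ℝ) ≤ c * ((n : ℝ) ^ τ + 1) ∧ (D ≤ p → s.reg 0 = 0) ∧ (q ≤ D → s.reg 0 ≠ 0) := by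
  obtain ⟨P, c, hP⟩ := h
  obtain ⟨a, b, hb, hab, hhi, hlo'⟩ := exists_natCast_div_btwn hgap
    (mul_pos (Nat.cast_pos.2 hq) hlo)
  refine ⟨.seq P (exceeds a b), c + (a + b + 2) + 5, fun n D G L hn hL hlen hw hD => ?_⟩
  obtain ⟨t, s, hhalts, ht, hs, hx, hx'⟩ := hP n D G L hn hL hlen hw hD
  have hV : (n + 2) ^ c * (a + b + 2) ≤ (n + 2) ^ (c + (a + b + 2) + 5) :=
    calc (n + 2) ^ c * (a + b + 2) ≤ (n + 2) ^ c * (n + 2) ^ (a + b + 2) :=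
          Nat.mul_le_mul_left _ (Nat.lt_pow_self (by omega)).le
      _ = (n + 2) ^ (c + (a + b + 2)) := (pow_add _ _ _).symm
      _ ≤ (n + 2) ^ (c + (a + b + 2) + 5) := Nat.pow_le_pow_right (by omega) (by omega)
  have reg_lt := hhalts.reg_lt (Nat.pow_pos (by omega))
  obtain ⟨hinput, run⟩ := hhalts.mono ((Nat.le_mul_of_pos_right _ (by omega)).trans hV)
  obtain ⟨s', run', hs'⟩ := exists_runs_exceeds hb (reg_lt 0) (reg_lt 1) hV hs
  refine ⟨t + 5, s', ⟨hinput, run.seq run'⟩, ?_, fun hDp => ?_, fun hDq => hs'.2 ?_⟩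
  · push_cast
    nlinarith [Real.rpow_nonneg n.cast_nonneg τ]
  · by_contra hacc
    have hDp' : (D : ℝ) ≤ p := by exact_mod_cast hDp
    have hpos : 0 < hi := pos_of_mul_pos_left (hab.trans ((hs'.1 hacc).trans_le hx')) D.cast_nonneg
    nlinarith [hs'.1 hacc]
  · have hDq' : (q : ℝ) ≤ D := by exact_mod_cast hDq
    nlinarith

namespace CNF
open WordRAM WordRAM.OVGraph
variable {N : ℕ} (φ : CNF N)

/-- The number of vertices of the graph of a formula with `m` clauses. -/
abbrev order (N m : ℕ) : ℕ := OVVertex.count (2 ^ blockVars N) m (numLeaves 1 (2 ^ blockVars N) m)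

/-- The edges of the graph of a formula. The leaves make the graph sparse. -/
abbrev edgeList : List (Fin (order N φ.length) × Fin (order N φ.length) × ℕ) := φ.toOV.edgeList _

/-- The size of the graph of a formula with `m` clauses, up to a constant factor. -/
def graphSize (N m : ℕ) : ℕ := (2 ^ blockVars N) ^ 2 * (m + 1) ^ 2

theorem length_edgeList_le : φ.edgeList.length ≤ 5 * order N φ.length := by
  have hleaves : numLeaves 1 (2 ^ blockVars N) φ.length ≤ order N φ.length := by
    simp only [order, OVVertex.count]
    omega
  rw [numLeaves, one_mul] at hleaves
  calc φ.edgeList.length ≤ 3 * (2 ^ blockVars N * 2 ^ blockVars N * (φ.length * φ.length)) +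
        2 * order N φ.length := φ.toOV.length_edgeList_le_count _
    _ ≤ 5 * order N φ.length := by omega

theorem size_le_graphSize (N m : ℕ) : size (2 ^ blockVars N) m ≤ 4 * graphSize N m :=
  calc size (2 ^ blockVars N) m ≤ (2 ^ blockVars N + 2 ^ blockVars N) ^ 2 * (m + 1) ^ 2 := by
        rw [size]
        gcongr
        exact Nat.one_le_two_pow
    _ = 4 * graphSize N m := by rw [graphSize]; ring

theorem order_le_graphSize (N m : ℕ) : order N m ≤ 8 * graphSize N m := by
  have := count_le_size (n := 2 ^ blockVars N) (d := m) le_rfl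
  have := size_le_graphSize N m
  simp only [order]
  omega

theorem order_add_two_le (N m : ℕ) : order N m + 2 ≤ (2 ^ N * (m + 2)) ^ 6 := by
  have hbase : 2 ≤ 2 ^ N * (m + 2) := by nlinarith [Nat.one_le_two_pow (n := N)]
  have hsize : 0 < graphSize N m := Nat.mul_pos (by positivity) (by positivity)
  calc order N m + 2 ≤ 2 ^ 4 * graphSize N m := by
        have := order_le_graphSize N m
        omega
    _ ≤ (2 ^ N * (m + 2)) ^ 4 * ((2 ^ N) ^ 2 * (m + 2) ^ 2) := by
      rw [graphSize]
      gcongr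
      · norm_num
      · exact blockVars_le N
      · norm_num
    _ = (2 ^ N * (m + 2)) ^ 6 := by ring

/-- The reduction from satisfiability to the diameter of a sparse graph. -/
def reduction (K : ℕ) : Prog := .seq (SatOV.prog K) (OVGraph.prog 1)

theorem exists_runs_reduction (K : ℕ) : ∃ c : ℕ, ∀ (N : ℕ) (φ : CNF N),
    (∀ cl ∈ φ, cl.length ≤ K) → ∀ W : ℕ, (2 ^ N * (φ.length + 2)) ^ c ≤ W →
      ∃ t ≤ c * graphSize N φ.length,
        Runs W (reduction K) (initState φ.encode) t (initState (encodeGraph _ φ.edgeList)) := by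
  obtain ⟨c₁, hsat⟩ := SatOV.exists_runs_prog K
  obtain ⟨c₂, hgraph⟩ := OVGraph.exists_runs_prog le_rfl
  refine ⟨c₁ + 4 * c₂, fun N φ hK W hW => ?_⟩
  have hbase : 2 ≤ 2 ^ N * (φ.length + 2) := by nlinarith [Nat.one_le_two_pow (n := N)]
  have hparams : 2 ^ blockVars N + φ.length + 2 ≤ (2 ^ N * (φ.length + 2)) ^ 2 := by
    have : 2 ^ blockVars N ≤ 2 ^ N := Nat.pow_le_pow_right two_pos (blockVars_le N)
    nlinarith [Nat.one_le_two_pow (n := N)]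
  obtain ⟨t₁, ht₁, run₁⟩ := hsat N φ hK W ((Nat.pow_le_pow_right (by omega) (by omega)).trans hW)
  obtain ⟨t₂, ht₂, run₂⟩ := hgraph _ _ φ.toOV W
    (calc (2 ^ blockVars N + φ.length + 2) ^ c₂ ≤ ((2 ^ N * (φ.length + 2)) ^ 2) ^ c₂ :=
          Nat.pow_le_pow_left hparams _
      _ = (2 ^ N * (φ.length + 2)) ^ (2 * c₂) := (pow_mul _ _ _).symm
      _ ≤ (2 ^ N * (φ.length + 2)) ^ (c₁ + 4 * c₂) := Nat.pow_le_pow_right (by omega) (by omega)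
      _ ≤ W := hW)
  have hsize₁ : SatOV.size N φ.length ≤ graphSize N φ.length :=
    Nat.mul_le_mul (Nat.le_self_pow two_ne_zero _) (Nat.le_self_pow two_ne_zero _)
  have hsize₂ := size_le_graphSize N φ.length
  exact ⟨t₁ + t₂, by nlinarith, run₁.seq run₂⟩

theorem lt_of_mem_encode {φ : CNF N} {K : ℕ} (hK : ∀ cl ∈ φ, cl.length ≤ K) {x : ℕ}
    (hx : x ∈ φ.encode) : x < (2 ^ N * (φ.length + 2)) ^ (K + 1) := by
  have hN : N < 2 ^ N := Nat.lt_two_pow_self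
  have hbase : 2 ≤ 2 ^ N * (φ.length + 2) := by nlinarith
  calc x ≤ 2 * N + φ.length + K := le_of_mem_encode hK hx
    _ < (K + 1) * (2 ^ N * (φ.length + 2)) := by nlinarith
    _ ≤ (2 ^ N * (φ.length + 2)) ^ K * (2 ^ N * (φ.length + 2)) := by
      gcongr
      exact Nat.lt_two_pow_self.trans_le (Nat.pow_le_pow_left hbase K)
    _ = (2 ^ N * (φ.length + 2)) ^ (K + 1) := (pow_succ _ _).symm

theorem exists_decides_of_sparseDiameterApprox {lo hi τ : ℝ} (hlo : 0 < lo)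
    (hgap : 6 * hi < 10 * lo) (h : SparseDiameterApprox 5 lo hi τ) (K : ℕ) :
    ∃ (P : Prog) (c : ℕ), ∀ (N : ℕ) (φ : CNF N), (∀ cl ∈ φ, cl.length ≤ K) →
      ∃ (t : ℕ) (s : State), HaltsOn ((2 ^ N * (φ.length + 2)) ^ c) P φ.encode t s ∧
        (t : ℝ) ≤ c * (graphSize N φ.length + ((order N φ.length : ℝ) ^ τ + 1)) ∧
        (s.reg 0 ≠ 0 ↔ φ.Satisfiable) := by
  obtain ⟨c₁, hreduction⟩ := exists_runs_reduction K
  obtain ⟨P, c₂, hP⟩ := h.exists_distinguishes (p := 6) (q := 10) hlo (by omega) (mod_cast hgap)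
  set c := c₁ + 6 * c₂ + (K + 1)
  refine ⟨.seq (reduction K) P, c, fun N φ hK => ?_⟩
  set Z := 2 ^ N * (φ.length + 2)
  have pow_le_pow_c {e : ℕ} (he : e ≤ c) : Z ^ e ≤ Z ^ c :=
    Nat.pow_le_pow_right (Nat.mul_pos (Nat.two_pow_pos N) (Nat.succ_pos _)) he
  obtain ⟨D, hD⟩ := φ.toOV.exists_diameter_graph_eq (numLeaves 1 _ _)
  obtain ⟨t₁, ht₁, run₁⟩ := hreduction N φ hK _ (pow_le_pow_c (by omega))
  obtain ⟨t₂, s, ⟨-, run₂⟩, ht₂, hreject, haccept⟩ := hP _ D _ _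
    (by simp only [OVVertex.count]; omega) (φ.toOV.isEdgeList_graph _) φ.length_edgeList_le
    (φ.toOV.weightsOneOrTwo_graph _) hD
  have hword : (order N φ.length + 2) ^ c₂ ≤ Z ^ c :=
    calc (order N φ.length + 2) ^ c₂ ≤ (Z ^ 6) ^ c₂ :=
          Nat.pow_le_pow_left (order_add_two_le N φ.length) c₂
      _ = Z ^ (6 * c₂) := (pow_mul _ _ _).symm
      _ ≤ Z ^ c := pow_le_pow_c (by omega)
  refine ⟨t₁ + t₂, s, ⟨fun x hx => (lt_of_mem_encode hK hx).trans_le (pow_le_pow_c (by omega)),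
    run₁.seq (run₂.mono hword)⟩, ?_, ?_⟩
  · have ht₁' : (t₁ : ℝ) ≤ c₁ * graphSize N φ.length := by exact_mod_cast ht₁
    have hc₁ : (c₁ : ℝ) ≤ c := by exact_mod_cast (by omega : c₁ ≤ c)
    have hc₂ : (c₂ : ℝ) ≤ c := by exact_mod_cast (by omega : c₂ ≤ c)
    rw [Nat.cast_add, mul_add]
    exact add_le_add (ht₁'.trans (by gcongr)) (ht₂.trans (by gcongr))
  · rw [← toOV_hasSolution_iff]
    refine ⟨fun hs => ?_, fun hI => haccept ?_⟩
    · by_contra hI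
      exact hs (hreject (by exact_mod_cast hD ▸ OVInstance.diameter_graph_le_six hI))
    · exact_mod_cast hD ▸ OVInstance.ten_le_diameter_graph hI

end CNF

namespace CNF
variable {δ β : ℝ}

theorem two_pow_blockVars_sq_rpow_le (hδ : 0 ≤ δ) (hβ : 0 ≤ β) (hβδ : β ≤ 3 / 2 - δ) (N : ℕ) :
    (((2 : ℝ) ^ blockVars N) ^ 2) ^ β ≤ 4 * (2 : ℝ) ^ ((1 - 2 * δ / 3) * N) := by
  have hblock : (3 : ℝ) * blockVars N ≤ N + 2 := by
    exact_mod_cast (by rw [blockVars]; omega : 3 * blockVars N ≤ N + 2)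
  have : (0 : ℝ) ≤ N := N.cast_nonneg
  calc (((2 : ℝ) ^ blockVars N) ^ 2) ^ β = (2 : ℝ) ^ ((blockVars N * 2 : ℕ) * β) := by
        rw [← pow_mul, Real.rpow_mul two_pos.le, Real.rpow_natCast]
    _ ≤ (2 : ℝ) ^ (2 + (1 - 2 * δ / 3) * N) := by
      refine Real.rpow_le_rpow_of_exponent_le one_le_two ?_
      push_cast
      nlinarith
    _ = 4 * (2 : ℝ) ^ ((1 - 2 * δ / 3) * N) := by
      rw [Real.rpow_add two_pos, Real.rpow_ofNat]
      norm_num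

theorem mul_graphSize_rpow_le (hδ : 0 ≤ δ) (hβ : 0 ≤ β) (hβδ : β ≤ 3 / 2 - δ) {k : ℝ} (hk : 1 ≤ k)
    (N m : ℕ) : (k * graphSize N m) ^ β ≤
      4 * k ^ 2 * ((2 : ℝ) ^ ((1 - 2 * δ / 3) * N) * ((m : ℝ) + 1) ^ 4) := by
  have rpow_le_sq {x : ℝ} (hx : 1 ≤ x) : x ^ β ≤ x ^ 2 := by
    rw [← Real.rpow_ofNat]
    exact Real.rpow_le_rpow_of_exponent_le hx (by linarith)
  have hm : 1 ≤ ((m : ℝ) + 1) ^ 2 := one_le_pow₀ (by linarith [m.cast_nonneg (α := ℝ)])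
  have hcast : (graphSize N m : ℝ) = ((2 : ℝ) ^ blockVars N) ^ 2 * ((m : ℝ) + 1) ^ 2 := by
    simp [graphSize]
  calc (k * graphSize N m) ^ β
      = k ^ β * ((((2 : ℝ) ^ blockVars N) ^ 2) ^ β * (((m : ℝ) + 1) ^ 2) ^ β) := by
        rw [hcast, Real.mul_rpow (by positivity) (by positivity),
          Real.mul_rpow (by positivity) (by positivity)]
    _ ≤ k ^ 2 * ((4 * (2 : ℝ) ^ ((1 - 2 * δ / 3) * N)) * (((m : ℝ) + 1) ^ 2) ^ 2) := by
      gcongr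
      · exact rpow_le_sq hk
      · exact two_pow_blockVars_sq_rpow_le hδ hβ hβδ N
      · exact rpow_le_sq hm
    _ = 4 * k ^ 2 * ((2 : ℝ) ^ ((1 - 2 * δ / 3) * N) * ((m : ℝ) + 1) ^ 4) := by ring

theorem graphSize_add_order_rpow_le (hδ : 0 ≤ δ) (hδ' : δ ≤ 1 / 2) (N m : ℕ) :
    graphSize N m + ((order N m : ℝ) ^ (3 / 2 - δ) + 1) ≤
      261 * ((2 : ℝ) ^ ((1 - 2 * δ / 3) * N) * ((m : ℝ) + 1) ^ 4) := by
  have hsize : (graphSize N m : ℝ) ≤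
      4 * ((2 : ℝ) ^ ((1 - 2 * δ / 3) * N) * ((m : ℝ) + 1) ^ 4) := by
    simpa using mul_graphSize_rpow_le hδ zero_le_one (by linarith) le_rfl N m
  have horder : (order N m : ℝ) ^ (3 / 2 - δ) ≤
      256 * ((2 : ℝ) ^ ((1 - 2 * δ / 3) * N) * ((m : ℝ) + 1) ^ 4) :=
    calc (order N m : ℝ) ^ (3 / 2 - δ) ≤ (8 * graphSize N m) ^ (3 / 2 - δ) :=
          Real.rpow_le_rpow (Nat.cast_nonneg _) (mod_cast order_le_graphSize N m) (by linarith)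
      _ ≤ 4 * 8 ^ 2 * ((2 : ℝ) ^ ((1 - 2 * δ / 3) * N) * ((m : ℝ) + 1) ^ 4) :=
        mul_graphSize_rpow_le hδ (by linarith) le_rfl (by norm_num) N m
      _ = 256 * ((2 : ℝ) ^ ((1 - 2 * δ / 3) * N) * ((m : ℝ) + 1) ^ 4) := by norm_num
  have hone : 1 ≤ (2 : ℝ) ^ ((1 - 2 * δ / 3) * N) * ((m : ℝ) + 1) ^ 4 :=
    one_le_mul_of_one_le_of_one_le
      (Real.one_le_rpow one_le_two (mul_nonneg (by linarith) N.cast_nonneg))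
      (one_le_pow₀ (by linarith [m.cast_nonneg (α := ℝ)]))
  linarith

end CNF

theorem SparseDiameterApprox.ksatSolvable {lo hi δ : ℝ} (hδ : 0 ≤ δ) (hδ' : δ ≤ 1 / 2)
    (hlo : 0 < lo) (hgap : 6 * hi < 10 * lo) (h : SparseDiameterApprox 5 lo hi (3 / 2 - δ))
    (K : ℕ) : KSATSolvable K (2 * δ / 3) := by
  obtain ⟨P, c, hP⟩ := CNF.exists_decides_of_sparseDiameterApprox hlo hgap h K
  refine ⟨P, 261 * c + 4, fun N φ hK => ?_⟩
  obtain ⟨t, s, hhalts, ht, hs⟩ := hP N φ hK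
  refine ⟨t, s, hhalts.mono (Nat.pow_le_pow_right (Nat.mul_pos (Nat.two_pow_pos N)
    (Nat.succ_pos _)) (by omega)), ?_, hs⟩
  calc (t : ℝ) ≤ c * (261 * ((2 : ℝ) ^ ((1 - 2 * δ / 3) * N) * ((φ.length : ℝ) + 1) ^ 4)) :=
        ht.trans (by gcongr; exact CNF.graphSize_add_order_rpow_le hδ hδ' N φ.length)
    _ = (261 * c : ℕ) * (2 : ℝ) ^ ((1 - 2 * δ / 3) * N) * ((φ.length : ℝ) + 1) ^ 4 := by
      push_cast
      ring
    _ ≤ (261 * c + 4 : ℕ) * (2 : ℝ) ^ ((1 - 2 * δ / 3) * N) *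
        ((N : ℝ) + φ.length + 1) ^ (261 * c + 4) := by
      gcongr
      · omega
      · exact (pow_le_pow_left₀ (by positivity) (by linarith [N.cast_nonneg (α := ℝ)]) 4).trans
          (pow_le_pow_right₀ (le_add_of_nonneg_left (by positivity)) (by omega))

theorem SparseDiameterApprox.mono {C₀ : ℕ} {lo hi τ τ' : ℝ} (hτ : τ ≤ τ')
    (h : SparseDiameterApprox C₀ lo hi τ) : SparseDiameterApprox C₀ lo hi τ' := by
  obtain ⟨P, c, hP⟩ := h
  refine ⟨P, c, fun n D G L hn hL hlen hw hD => ?_⟩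
  obtain ⟨t, s, hhalts, ht, happrox⟩ := hP n D G L hn hL hlen hw hD
  have : (1 : ℝ) ≤ n := by exact_mod_cast hn
  exact ⟨t, s, hhalts, ht.trans (by gcongr), happrox⟩

theorem mainTheorem3 :
    (∃ (P : WordRAM.Prog) (c : ℕ), ∀ (n d : ℕ), 1 ≤ n → 1 ≤ d → ∀ I : OVInstance 3 n d,
      ∃ (t : ℕ) (s : WordRAM.State) (N : ℕ) (G : WeightedGraph (Fin N))
        (L : List (Fin N × Fin N × ℕ)),
        WordRAM.HaltsOn ((n + d + 2) ^ c) P I.encode t s ∧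
        t ≤ c * (n ^ 2 * d ^ 2) ∧
        IsEdgeList G L ∧
        s.Outputs (encodeGraph N L) ∧
        N ≤ c * (n ^ 2 + n * d ^ 2) ∧
        L.length ≤ c * (n ^ 2 * d ^ 2) ∧
        G.WeightsOneOrTwo ∧
        (¬ I.HasSolution → ∀ u v : Fin N, G.dist u v ≤ 6) ∧
        (I.HasSolution → ∃ u v : Fin N, 10 ≤ G.dist u v)) ∧
    (SETH → ∃ C₀ : ℕ, ∀ ε δ lo hi : ℝ, 0 < ε → 0 < δ → 0 < lo → hi ≤ (5 / 3 - ε) * lo →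
      ¬ SparseDiameterApprox C₀ lo hi (3 / 2 - δ)) := by
  refine ⟨WordRAM.OVGraph.exists_reduction, fun hSETH => ⟨5, fun ε δ lo hi hε hδ hlo hhi h => ?_⟩⟩
  have hδ' : 0 < min δ (1 / 2) := lt_min hδ (by norm_num)
  obtain ⟨K, hK⟩ := hSETH (2 * min δ (1 / 2) / 3) (by linarith)
  have hgap : 6 * hi < 10 * lo := by nlinarith [mul_pos hε hlo]
  have hτ : 3 / 2 - δ ≤ 3 / 2 - min δ (1 / 2) := by linarith [min_le_left δ (1 / 2)]
  exact hK ((h.mono hτ).ksatSolvable hδ'.le (min_le_right _ _) hlo hgap K)
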